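/- A virtual double category $\mathbb{D}$ consists of a category $\mathbb{D}_0$ of objects and vertical arrows, proarrows $A\colon c\nrightarrow d$ between objects, and 2-cells $\phi\in{}_f\mathbb{D}_g(A_1,\dots,A_n;B)$ ($n\ge 0$) whose source is a composable string of proarrows $A_1,\dots,A_n$ from $c_0$ to $c_n$, whose target is a proarrow $B\colon d_0\nrightarrow d_1$, and whose frames are vertical arrows $f\colon c_0\to d_0$, $g\colon c_n\to d_1$, with identity 2-cells and an associative and unital multi-composition. A cell $\kappa\in{}_f\mathbb{D}_g(P;Q)$ is cartesian if composing with it gives bijections ${}_h\mathbb{D}_k(R_1,\dots,R_n;P)\cong{}_{fh}\mathbb{D}_{gk}(R_1,\dots,R_n;Q)$; a cell $(P_1,\dots,P_n)\to Q$ with identity frames is opcartesian if composing with it gives bijections ${}_f\mathbb{D}_g(\vec R,Q,\vec S;T)\cong{}_f\mathbb{D}_g(\vec R,\vec P,\vec S;T)$. A unit of $c$ is a proarrow $U_c\colon c\nrightarrow c$ with an opcartesian cell from the empty string at $c$. $\mathbb{D}$ is a virtual equipment if every object has a unit and for all $f,g,Q$ there is a cartesian cell over $f,g$ with target $Q$.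 $\mathrm{Mod}(\mathbb{D})$ is the virtual double category whose objects are the monoids $(c,M)$ in $\mathbb{D}$ (a proarrow $M\colon c\nrightarrow c$ with a unit cell and a multiplication cell, associative and unital), whose vertical arrows are the monoid homomorphisms $(f,\vec f)$ ($f\colon c\to d$ a vertical arrow and $\vec f\in{}_f\mathbb{D}_f(M;N)$ a cell that respects units and multiplications), whose proarrows are the bimodules, and whose 2-cells are the bimodule homomorphisms, i.e. the cells of $\mathbb{D}$ compatible with all actions. In a virtual equipment, every object $x$ carries a trivial monoid on $U_x$, and every proarrow is a bimodule between trivial monoids. An embedding of a monoid $M$ into $x$ is a homomorphism from $M$ to the trivial monoid on $x$; a collapse of $M$ is a universal embedding $i\colon M\to x$ (every embedding of $M$ factors through $i$ by a unique vertical arrow out of $x$). An embedding of an $(M,N)$-bimodule $B$ into a proarrow $P\colon x\nrightarrow y$, over embeddings of $M$ and $N$, is a bimodule homomorphism from $B$ to $P$; it is a bimodule collapse if it lies over collapses $i\colon M\to x$, $j\colon N\to y$ and, for all $h\colon x\to x'$, $k\colon y\to y'$ and $Q\colon x'\nrightarrow y'$, composing with it is a bijection from ${}_h\mathbb{D}_k(P;Q)$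 to the embeddings of $B$ into $Q$ over $hi$ and $kj$. A collapse $(i,\vec\imath)\colon M\to x$ is normal if $\vec\imath\colon M\to U_x$ is also a bimodule collapse of $M$ regarded as an $(M,M)$-bimodule. The kernel of $f\colon c\to d$ is the restriction of $U_d$ along $f$ on both sides, with the unique monoid structure that makes its cartesian cell an embedding into $d$; $f$ is a regular cover if this embedding is a normal collapse. A monoid is effective if it is a kernel. A virtual equipment is regular if (1) every effective monoid has a normal collapse, and (2) for all regular covers $f\colon c\to d$, $g\colon c'\to d'$ and every proarrow $B\colon d\nrightarrow d'$, every cartesian embedding of a $(\ker f,\ker g)$-bimodule into $B$ over the kernel embeddings of $f$ and $g$ is a bimodule collapse. **Proposition.** Let $\mathbb{D}$ be a virtual equipment. Then $\mathrm{Mod}(\mathbb{D})$ is a regular virtual equipment. Moreover: (a) every monoid in $\mathrm{Mod}(\mathbb{D})$ has a normal collapse; (b) a vertical arrow $(f,\vec f)$ of $\mathrm{Mod}(\mathbb{D})$ is a regular cover if and only if $f$ is an isomorphism in $\mathbb{D}_0$; (c) if $F\colon X\to Y$ and $G\colon X'\to Y'$ are regular covers in $\mathrm{Mod}(\mathbb{D})$,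 then a 2-cell $\phi\colon A\to B$ with one-term source and with frames $F$ and $G$ is cartesian if and only if its underlying 2-cell in $\mathbb{D}$ is an isomorphism; and an embedding of a $(\ker F,\ker G)$-bimodule into a proarrow $Y\nrightarrow Y'$, over the kernel embeddings of $F$ and $G$, is a bimodule collapse if and only if it is cartesian. -/

import Mathlib

open CategoryTheory

universe w z v u

namespace VDC

/-- Composable strings `A₁, …, Aₙ` (`n ≥ 0`) of proarrows. -/
inductive HPath {C : Type u} (Pro : C → C → Type w) : C → C → Type (max u w)
  | nil (a : C) : HPath Pro a a
  | cons {a b c : C} (A : Pro a b) (P : HPath Pro b c) : HPath Pro a c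

/-- Concatenation of composable strings. -/
def HPath.append {C : Type u} {Pro : C → C → Type w} :
    {a b c : C} → HPath Pro a b → HPath Pro b c → HPath Pro a c
  | _, _, _, .nil _, Q => Q
  | _, _, _, .cons A P, Q => .cons A (P.append Q)

/-- The string of length one. -/
abbrev HPath.one {C : Type u} {Pro : C → C → Type w} {a b : C} (A : Pro a b) : HPath Pro a b :=
  .cons A (.nil b)

theorem HPath.append_nil {C : Type u} {Pro : C → C → Type w} {a b : C} (P : HPath Pro a b) :
    P.append (.nil b) = P := by
  induction P with
  | nil => rfl
  | cons A P ih => simp only [HPath.append, ih]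

theorem HPath.append_assoc {C : Type u} {Pro : C → C → Type w} {a b c d : C}
    (P : HPath Pro a b) (Q : HPath Pro b c) (R : HPath Pro c d) :
    (P.append Q).append R = P.append (Q.append R) := by
  induction P with
  | nil => rfl
  | cons A P ih => simp only [HPath.append, ih]

/-- Proarrows and 2-cells on a vertical category `C`; `Cell f g P B` is the set of 2-cells with
left frame `f`, right frame `g`, multi-source the string `P` and target `B`. -/
class VirtualDoubleGraph (C : Type u) [Category.{v} C] where
  Pro : C → C → Type w
  Cell : {a b a' b' : C} → (a ⟶ a') → (b ⟶ b') → HPath Pro a b → Pro a' b' → Type z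

open VirtualDoubleGraph

/-- Horizontally composable strings of 2-cells: adjacent cells share their frame.  The
source of such a string is the concatenation of the sources of the cells, and its target is the
string of their targets.  The concatenation is recorded by an equation. -/
inductive CellPath {C : Type u} [Category.{v} C] [VirtualDoubleGraph.{w, z} C] :
    {a b a' b' : C} → (a ⟶ a') → (b ⟶ b') → HPath (Pro (C := C)) a b →
      HPath (Pro (C := C)) a' b' → Type (max u v w z)
  | nil {a a' : C} (f : a ⟶ a') : CellPath f f (.nil a) (.nil a')
  | cons {a b c a' b' c' : C} {f : a ⟶ a'} {g : b ⟶ b'} {h : c ⟶ c'}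
      {R : HPath (Pro (C := C)) a b} {B : Pro a' b'} {P : HPath (Pro (C := C)) b c}
      {Q : HPath (Pro (C := C)) b' c'} {S : HPath (Pro (C := C)) a c}
      (φ : Cell f g R B) (φs : CellPath g h P Q) (hS : S = R.append P) :
      CellPath f h S (.cons B Q)

section Graph

variable {C : Type u} [Category.{v} C] [VirtualDoubleGraph.{w, z} C]

/-- The string consisting of one cell. -/
def CellPath.one {a b a' b' : C} {f : a ⟶ a'} {g : b ⟶ b'} {R : HPath (Pro (C := C)) a b}
    {B : Pro a' b'} (φ : Cell f g R B) : CellPath f g R (.one B) :=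
  .cons φ (.nil g) R.append_nil.symm

/-- The string consisting of two cells. -/
def CellPath.two {a b c a' b' c' : C} {f : a ⟶ a'} {g : b ⟶ b'} {h : c ⟶ c'}
    {R : HPath (Pro (C := C)) a b} {B : Pro a' b'} {S : HPath (Pro (C := C)) b c}
    {B' : Pro b' c'} {T : HPath (Pro (C := C)) a c} (φ : Cell f g R B) (ψ : Cell g h S B')
    (hT : T = R.append S) : CellPath f h T (.cons B (.one B')) :=
  .cons φ (.one ψ) hT

/-- Concatenation of strings of cells. -/
def CellPath.append {a b c a' b' c' : C} {f : a ⟶ a'} {g : b ⟶ b'} {h : c ⟶ c'}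
    {P : HPath (Pro (C := C)) a b} {Q : HPath (Pro (C := C)) a' b'}
    {P' : HPath (Pro (C := C)) b c} {Q' : HPath (Pro (C := C)) b' c'} :
    CellPath f g P Q → CellPath g h P' Q' → CellPath f h (P.append P') (Q.append Q')
  | .nil _, y => y
  | .cons φ x hS, y => .cons φ (x.append y) (by rw [hS, HPath.append_assoc])

/-- `IsAppend x y z`: the string `z` is the concatenation of `x` and `y` (as a relation, so that
the source and target of `z` need only be provably equal to the concatenations). -/
inductive IsAppend : {a b c a' b' c' : C} → {f : a ⟶ a'} → {g : b ⟶ b'} → {h : c ⟶ c'} →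
    {P : HPath (Pro (C := C)) a b} → {Q : HPath (Pro (C := C)) a' b'} →
    {P' : HPath (Pro (C := C)) b c} → {Q' : HPath (Pro (C := C)) b' c'} →
    {S : HPath (Pro (C := C)) a c} → {T : HPath (Pro (C := C)) a' c'} →
    CellPath f g P Q → CellPath g h P' Q' → CellPath f h S T → Prop
  | nil {a b a' b' : C} (f : a ⟶ a') {g : b ⟶ b'} {P : HPath (Pro (C := C)) a b}
      {Q : HPath (Pro (C := C)) a' b'} (y : CellPath f g P Q) : IsAppend (.nil f) y y
  | cons {a b c d a' b' c' d' : C} {f : a ⟶ a'} {g : b ⟶ b'} {h : c ⟶ c'} {k : d ⟶ d'}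
      {R : HPath (Pro (C := C)) a b} {B : Pro a' b'}
      {P : HPath (Pro (C := C)) b c} {Q : HPath (Pro (C := C)) b' c'}
      {P' : HPath (Pro (C := C)) c d} {Q' : HPath (Pro (C := C)) c' d'}
      {S : HPath (Pro (C := C)) b d} {T : HPath (Pro (C := C)) b' d'}
      {P₁ : HPath (Pro (C := C)) a c} {S₁ : HPath (Pro (C := C)) a d}
      (φ : Cell f g R B) {x : CellPath g h P Q} {y : CellPath h k P' Q'} {z : CellPath g k S T}
      (hxyz : IsAppend x y z) (hx : P₁ = R.append P) (hz : S₁ = R.append S) :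
      IsAppend (.cons φ x hx) y (.cons φ z hz)

end Graph

/-- Identity cells and multi-composition.  The frames of a composite are the composites of the
frames; this is recorded by equations. -/
class VirtualDoubleStruct (C : Type u) [Category.{v} C] extends VirtualDoubleGraph.{w, z} C where
  idc : {a b : C} → (A : Pro a b) → Cell (𝟙 a) (𝟙 b) (.one A) A
  comp : {a b a' b' a'' b'' : C} → {f : a ⟶ a'} → {g : b ⟶ b'} → {f' : a' ⟶ a''} →
    {g' : b' ⟶ b''} → {u : a ⟶ a''} → {v : b ⟶ b''} → {P : HPath Pro a b} →
    {Q : HPath Pro a' b'} → {B : Pro a'' b''} →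
    CellPath f g P Q → Cell f' g' Q B → f ≫ f' = u → g ≫ g' = v → Cell u v P B

open VirtualDoubleStruct

section Struct

variable {C : Type u} [Category.{v} C] [VirtualDoubleStruct.{w, z} C]

/-- The string of identity cells on a string of proarrows. -/
def CellPath.ids : {a b : C} → (P : HPath (Pro (C := C)) a b) → CellPath (𝟙 a) (𝟙 b) P P
  | _, _, .nil a => .nil (𝟙 a)
  | _, _, .cons A P => .cons (idc A) (CellPath.ids P) rfl

/-- `VComp x y z`: the string `z` is the vertical composite of the string `x` followed by the
string `y`, i.e. each cell `φ` of `y` is composed with the segment of `x` lying over its source. -/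
inductive VComp : {a b a' b' a'' b'' : C} → {f : a ⟶ a'} → {g : b ⟶ b'} →
    {f' : a' ⟶ a''} → {g' : b' ⟶ b''} → {u : a ⟶ a''} → {v : b ⟶ b''} →
    {P : HPath (Pro (C := C)) a b} → {Q : HPath (Pro (C := C)) a' b'} →
    {R : HPath (Pro (C := C)) a'' b''} →
    CellPath f g P Q → CellPath f' g' Q R → CellPath u v P R → Prop
  | nil {a a' a'' : C} {f : a ⟶ a'} {f' : a' ⟶ a''} {u : a ⟶ a''} (h : f ≫ f' = u) :
      VComp (.nil f) (.nil f') (.nil u)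
  | cons {a b c a' b' c' a'' b'' c'' : C} {f : a ⟶ a'} {g : b ⟶ b'} {h : c ⟶ c'}
      {f' : a' ⟶ a''} {g' : b' ⟶ b''} {h' : c' ⟶ c''}
      {u : a ⟶ a''} {v : b ⟶ b''} {w : c ⟶ c''}
      {P₁ : HPath (Pro (C := C)) a b} {Q₁ : HPath (Pro (C := C)) a' b'} {B : Pro a'' b''}
      {P₂ : HPath (Pro (C := C)) b c} {Q₂ : HPath (Pro (C := C)) b' c'}
      {R : HPath (Pro (C := C)) b'' c''}
      {P : HPath (Pro (C := C)) a c} {Q : HPath (Pro (C := C)) a' c'}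
      {x₁ : CellPath f g P₁ Q₁} {x₂ : CellPath g h P₂ Q₂} {x : CellPath f h P Q}
      {φ : Cell f' g' Q₁ B} {y : CellPath g' h' Q₂ R} {z : CellPath v w P₂ R}
      (hx : IsAppend x₁ x₂ x) (hu : f ≫ f' = u) (hv : g ≫ g' = v) (hz : VComp x₂ y z)
      (hQ : Q = Q₁.append Q₂) (hP : P = P₁.append P₂) :
      VComp x (.cons φ y hQ) (.cons (comp x₁ φ hu hv) z hP)

end Struct

/-- A virtual double category with vertical category `C`. -/
class VirtualDoubleCategory (C : Type u) [Category.{v} C] extends VirtualDoubleStruct.{w, z} C where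
  ids_comp : ∀ {a b a' b' : C} {f : a ⟶ a'} {g : b ⟶ b'} {P : HPath Pro a b} {B : Pro a' b'}
    (φ : Cell f g P B), comp (CellPath.ids P) φ (Category.id_comp f) (Category.id_comp g) = φ
  comp_idc : ∀ {a b a' b' : C} {f : a ⟶ a'} {g : b ⟶ b'} {P : HPath Pro a b} {B : Pro a' b'}
    (φ : Cell f g P B),
    comp (CellPath.one φ) (idc B) (Category.comp_id f) (Category.comp_id g) = φ
  assoc : ∀ {a b a' b' a'' b'' a₃ b₃ : C} {f : a ⟶ a'} {g : b ⟶ b'} {f' : a' ⟶ a''}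
    {g' : b' ⟶ b''} {u : a ⟶ a''} {v : b ⟶ b''} {f'' : a'' ⟶ a₃} {g'' : b'' ⟶ b₃}
    {s : a' ⟶ a₃} {t : b' ⟶ b₃} {p : a ⟶ a₃} {q : b ⟶ b₃}
    {P : HPath Pro a b} {Q : HPath Pro a' b'} {R : HPath Pro a'' b''} {B : Pro a₃ b₃}
    {x : CellPath f g P Q} {y : CellPath f' g' Q R} {z : CellPath u v P R} (ψ : Cell f'' g'' R B)
    (_ : VComp x y z) (hs : f' ≫ f'' = s) (ht : g' ≫ g'' = t) (hp : f ≫ s = p) (hq : g ≫ t = q)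
    (hp' : u ≫ f'' = p) (hq' : v ≫ g'' = q),
    comp x (comp y ψ hs ht) hp hq = comp z ψ hp' hq'

open VirtualDoubleCategory

section Basic

variable {C : Type u} [Category.{v} C] [VirtualDoubleCategory.{w, z} C]

theorem isAppend_append {a b c a' b' c' : C} {f : a ⟶ a'} {g : b ⟶ b'} {h : c ⟶ c'}
    {P : HPath (Pro (C := C)) a b} {Q : HPath (Pro (C := C)) a' b'}
    {P' : HPath (Pro (C := C)) b c} {Q' : HPath (Pro (C := C)) b' c'}
    (x : CellPath f g P Q) (y : CellPath g h P' Q') : IsAppend x y (x.append y) := by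
  induction x with
  | nil f => exact .nil f y
  | cons φ x hS ih => exact .cons φ (ih y) hS _

theorem isAppend_ids {a b c : C} (P : HPath (Pro (C := C)) a b) (Q : HPath (Pro (C := C)) b c) :
    IsAppend (CellPath.ids P) (CellPath.ids Q) (CellPath.ids (P.append Q)) := by
  induction P with
  | nil a => exact .nil _ _
  | cons A P ih => exact .cons _ (ih Q) rfl rfl

theorem isAppend_one {a b c a' b' c' : C} {f : a ⟶ a'} {g : b ⟶ b'} {h : c ⟶ c'}
    {R : HPath (Pro (C := C)) a b} {B : Pro a' b'} {P : HPath (Pro (C := C)) b c}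
    {Q : HPath (Pro (C := C)) b' c'} {S : HPath (Pro (C := C)) a c}
    (φ : Cell f g R B) (φs : CellPath g h P Q) (hS : S = R.append P) :
    IsAppend (.one φ) φs (.cons φ φs hS) :=
  .cons φ (.nil _ _) _ _

theorem VComp.cons' {a b c a' b' c' a'' b'' c'' : C} {f : a ⟶ a'} {g : b ⟶ b'} {h : c ⟶ c'}
      {f' : a' ⟶ a''} {g' : b' ⟶ b''} {h' : c' ⟶ c''}
      {u : a ⟶ a''} {v : b ⟶ b''} {w : c ⟶ c''}
      {P₁ : HPath (Pro (C := C)) a b} {Q₁ : HPath (Pro (C := C)) a' b'} {B : Pro a'' b''}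
      {P₂ : HPath (Pro (C := C)) b c} {Q₂ : HPath (Pro (C := C)) b' c'}
      {R : HPath (Pro (C := C)) b'' c''}
      {P : HPath (Pro (C := C)) a c} {Q : HPath (Pro (C := C)) a' c'}
      {x₁ : CellPath f g P₁ Q₁} {x₂ : CellPath g h P₂ Q₂} {x : CellPath f h P Q}
      {φ : Cell f' g' Q₁ B} {y : CellPath g' h' Q₂ R} {z : CellPath v w P₂ R} {χ : Cell u v P₁ B}
      (hx : IsAppend x₁ x₂ x) (hu : f ≫ f' = u) (hv : g ≫ g' = v) (hχ : comp x₁ φ hu hv = χ)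
      (hz : VComp x₂ y z) (hQ : Q = Q₁.append Q₂) (hP : P = P₁.append P₂) :
      VComp x (.cons φ y hQ) (.cons χ z hP) := by
  subst hχ
  exact .cons hx hu hv hz hQ hP

theorem vcomp_ids {a b a' b' : C} {f : a ⟶ a'} {g : b ⟶ b'} {P : HPath (Pro (C := C)) a b}
    {Q : HPath (Pro (C := C)) a' b'} (x : CellPath f g P Q) : VComp x (CellPath.ids Q) x := by
  induction x with
  | nil f => exact .nil (Category.comp_id f)
  | cons φ x hS ih =>
    exact .cons' (isAppend_one φ x hS) _ _ (comp_idc φ) ih _ hS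

theorem ids_vcomp {a b a' b' : C} {f : a ⟶ a'} {g : b ⟶ b'} {P : HPath (Pro (C := C)) a b}
    {Q : HPath (Pro (C := C)) a' b'} (x : CellPath f g P Q) : VComp (CellPath.ids P) x x := by
  induction x with
  | nil f => exact .nil (Category.id_comp f)
  | cons φ x hS ih =>
    subst hS
    exact .cons' (isAppend_ids _ _) _ _ (ids_comp φ) ih _ rfl

theorem isAppend_nil {a b a' b' : C} {f : a ⟶ a'} {g : b ⟶ b'} {P : HPath (Pro (C := C)) a b}
    {Q : HPath (Pro (C := C)) a' b'} (x : CellPath f g P Q) : IsAppend x (.nil g) x := by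
  induction x with
  | nil f => exact .nil _ _
  | cons φ x hS ih => exact .cons φ ih hS hS

theorem vcomp_one {a b a' b' a'' b'' : C} {f : a ⟶ a'} {g : b ⟶ b'} {f' : a' ⟶ a''}
    {g' : b' ⟶ b''} {u : a ⟶ a''} {v : b ⟶ b''} {P : HPath (Pro (C := C)) a b}
    {Q : HPath (Pro (C := C)) a' b'} {B : Pro a'' b''} (x : CellPath f g P Q) (φ : Cell f' g' Q B)
    (hu : f ≫ f' = u) (hv : g ≫ g' = v) : VComp x (.one φ) (.one (comp x φ hu hv)) := by
  exact .cons (x₂ := .nil g) (P₂ := .nil b) (isAppend_nil x) hu hv (.nil hv) _ _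

theorem vcomp_two {a b c a' b' c' a'' b'' c'' : C} {f : a ⟶ a'} {g : b ⟶ b'} {h : c ⟶ c'}
      {f' : a' ⟶ a''} {g' : b' ⟶ b''} {h' : c' ⟶ c''}
      {u : a ⟶ a''} {v : b ⟶ b''} {w : c ⟶ c''}
      {P₁ : HPath (Pro (C := C)) a b} {Q₁ : HPath (Pro (C := C)) a' b'} {B : Pro a'' b''}
      {P₂ : HPath (Pro (C := C)) b c} {Q₂ : HPath (Pro (C := C)) b' c'} {B' : Pro b'' c''}
      {x₁ : CellPath f g P₁ Q₁} {x₂ : CellPath g h P₂ Q₂}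
      {P : HPath (Pro (C := C)) a c} {Q : HPath (Pro (C := C)) a' c'} {x : CellPath f h P Q}
      {φ : Cell f' g' Q₁ B} {ψ : Cell g' h' Q₂ B'} {χ : Cell u v P₁ B} {ω : Cell v w P₂ B'}
      (hx : IsAppend x₁ x₂ x) (hu : f ≫ f' = u) (hv : g ≫ g' = v) (hw : h ≫ h' = w)
      (hχ : comp x₁ φ hu hv = χ) (hω : comp x₂ ψ hv hw = ω)
      (hQ : Q = Q₁.append Q₂) (hP : P = P₁.append P₂) :
      VComp x (.two φ ψ hQ) (.two χ ω hP) := by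
  subst hχ hω
  exact .cons hx hu hv (vcomp_one x₂ ψ hv hw) _ _

end Basic

section Monoids

variable {C : Type u} [Category.{v} C] [VirtualDoubleCategory.{w, z} C]

/-- A monoid structure over the object `c`. -/
structure MonoidOn (c : C) where
  pro : Pro c c
  one : Cell (𝟙 c) (𝟙 c) (.nil c) pro
  mul : Cell (𝟙 c) (𝟙 c) (.cons pro (.one pro)) pro
  one_mul : comp (P := .one pro) (.two one (idc pro) rfl) mul (Category.id_comp _) (Category.id_comp _) = idc pro
  mul_one : comp (P := .one pro) (.two (idc pro) one rfl) mul (Category.id_comp _) (Category.id_comp _) = idc pro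
  mul_assoc : comp (P := .cons pro (.cons pro (.one pro))) (.two mul (idc pro) rfl) mul
      (Category.id_comp _) (Category.id_comp _) =
    comp (P := .cons pro (.cons pro (.one pro))) (.two (idc pro) mul rfl) mul (Category.id_comp _) (Category.id_comp _)

variable (C) in
/-- Objects of `Mod`: monoids in the virtual double category `C`. -/
structure Mod where
  obj : C
  mon : MonoidOn obj

/-- The underlying proarrow of a monoid. -/
abbrev Mod.pro (M : Mod C) : Pro M.obj M.obj := M.mon.pro

/-- Monoid homomorphisms. -/
structure MonHom (M N : Mod C) where
  hom : M.obj ⟶ N.obj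
  cell : Cell hom hom (.one M.pro) N.pro
  map_one : comp (.one M.mon.one) cell (Category.id_comp hom) (Category.id_comp hom) =
    comp (.nil hom) N.mon.one (Category.comp_id hom) (Category.comp_id hom)
  map_mul : comp (.one M.mon.mul) cell (Category.id_comp hom) (Category.id_comp hom) =
    comp (P := .cons M.pro (.one M.pro)) (.two cell cell rfl) N.mon.mul (Category.comp_id hom) (Category.comp_id hom)

theorem MonHom.ext_comp {M N : Mod C} {F G : MonHom M N} (h : F.hom = G.hom)
    (hc : comp (.one F.cell) (idc N.pro) ((Category.comp_id _).trans h)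
      ((Category.comp_id _).trans h) = G.cell) : F = G := by
  obtain ⟨f, φ, _, _⟩ := F
  obtain ⟨g, ψ, _, _⟩ := G
  dsimp only at h
  subst h
  have : φ = ψ := (comp_idc φ).symm.trans hc
  subst this
  rfl

/-- The identity homomorphism. -/
def MonHom.id (M : Mod C) : MonHom M M where
  hom := 𝟙 _
  cell := idc _
  map_one := by
    rw [comp_idc]
    exact (ids_comp M.mon.one).symm
  map_mul := by
    rw [comp_idc]
    exact (ids_comp M.mon.mul).symm

/-- Composition of homomorphisms. -/
def MonHom.comp {M N K : Mod C} (F : MonHom M N) (G : MonHom N K) : MonHom M K where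
  hom := F.hom ≫ G.hom
  cell := VirtualDoubleStruct.comp (.one F.cell) G.cell rfl rfl
  map_one := by
    rw [assoc G.cell (vcomp_one (.one M.mon.one) F.cell (Category.id_comp _) (Category.id_comp _))
      rfl rfl _ _ rfl rfl, F.map_one,
      ← assoc G.cell (vcomp_one (.nil F.hom) N.mon.one (Category.comp_id _) (Category.comp_id _))
      (Category.id_comp _) (Category.id_comp _) rfl rfl rfl rfl, G.map_one]
    exact assoc _ (.nil rfl) _ _ _ _ _ _
  map_mul := by
    rw [assoc G.cell (vcomp_one (.one M.mon.mul) F.cell (Category.id_comp _) (Category.id_comp _))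
      rfl rfl _ _ rfl rfl, F.map_mul,
      ← assoc G.cell (vcomp_one (P := .cons M.pro (.one M.pro)) (.two F.cell F.cell rfl) N.mon.mul (Category.comp_id _)
        (Category.comp_id _))
      (Category.id_comp _) (Category.id_comp _) rfl rfl rfl rfl, G.map_mul]
    exact assoc _ (vcomp_two (isAppend_one _ _ _) rfl rfl rfl rfl rfl _ _) _ _ _ _ _ _

instance : Category (Mod C) where
  Hom := MonHom
  id := MonHom.id
  comp := MonHom.comp
  id_comp F := MonHom.ext_comp (Category.id_comp F.hom)
    ((assoc _ (vcomp_one _ F.cell rfl rfl) (Category.comp_id _) (Category.comp_id _)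
      (Category.id_comp _) (Category.id_comp _) _ _).symm.trans
      ((congrArg (fun t => VirtualDoubleStruct.comp _ t _ _) (comp_idc F.cell)).trans
        (ids_comp F.cell)))
  comp_id F := MonHom.ext_comp (Category.comp_id F.hom)
    ((assoc _ (vcomp_one (.one F.cell) (idc _) rfl rfl) (Category.comp_id _) (Category.comp_id _)
      (Category.comp_id _) (Category.comp_id _) _ _).symm.trans
      ((congrArg (fun t => VirtualDoubleStruct.comp _ t _ _) (comp_idc (idc _))).trans
        (comp_idc F.cell)))
  assoc F G H := MonHom.ext_comp (Category.assoc F.hom G.hom H.hom)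
    ((assoc _ (vcomp_one (.one (F.comp G).cell) H.cell rfl rfl) (Category.comp_id _)
      (Category.comp_id _) (Category.assoc _ _ _) (Category.assoc _ _ _) _ _).symm.trans
      ((congrArg (fun t => VirtualDoubleStruct.comp _ t _ _) (comp_idc H.cell)).trans
        (assoc H.cell (vcomp_one (.one F.cell) G.cell rfl rfl) rfl rfl rfl rfl _ _).symm))

/-- Bimodules between monoids. -/
structure Bimod (M N : Mod C) where
  pro : Pro M.obj N.obj
  left : Cell (𝟙 _) (𝟙 _) (.cons M.pro (.one pro)) pro
  right : Cell (𝟙 _) (𝟙 _) (.cons pro (.one N.pro)) pro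
  one_left : comp (P := .one pro) (.two M.mon.one (idc pro) rfl) left
      (Category.id_comp _) (Category.id_comp _) = idc pro
  mul_left : comp (P := .cons M.pro (.cons M.pro (.one pro))) (.two M.mon.mul (idc pro) rfl) left
      (Category.id_comp _) (Category.id_comp _) =
    comp (P := .cons M.pro (.cons M.pro (.one pro))) (.two (idc M.pro) left rfl) left
      (Category.id_comp _) (Category.id_comp _)
  right_one : comp (P := .one pro) (.two (idc pro) N.mon.one rfl) right
      (Category.id_comp _) (Category.id_comp _) = idc pro
  right_mul : comp (P := .cons pro (.cons N.pro (.one N.pro))) (.two (idc pro) N.mon.mul rfl) right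
      (Category.id_comp _) (Category.id_comp _) =
    comp (P := .cons pro (.cons N.pro (.one N.pro))) (.two right (idc N.pro) rfl) right
      (Category.id_comp _) (Category.id_comp _)
  left_right : comp (P := .cons M.pro (.cons pro (.one N.pro))) (.two left (idc N.pro) rfl) right
      (Category.id_comp _) (Category.id_comp _) =
    comp (P := .cons M.pro (.cons pro (.one N.pro))) (.two (idc M.pro) right rfl) left
      (Category.id_comp _) (Category.id_comp _)

/-- The string of underlying proarrows of a string of bimodules. -/
def under : {M N : Mod C} → HPath (Bimod (C := C)) M N → HPath (Pro (C := C)) M.obj N.obj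
  | _, _, .nil M => .nil M.obj
  | _, _, .cons A P => .cons A.pro (under P)

theorem under_append {M N K : Mod C} (P : HPath (Bimod (C := C)) M N)
    (Q : HPath (Bimod (C := C)) N K) : under (P.append Q) = (under P).append (under Q) := by
  induction P with
  | nil => rfl
  | cons A P ih => simp only [HPath.append, under, ih]

/-- `InnerPair P x y`: for some adjacent bimodules `A, A'` of the string `P`, with middle monoid
`L`, the strings `x` and `y` from `…, A, L, A', …` to `…, A, A', …` are given by the right action
of `L` on `A`, resp. by the left action of `L` on `A'`. -/
inductive InnerPair : {M N : Mod C} → (P : HPath (Bimod (C := C)) M N) →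
    {W : HPath (Pro (C := C)) M.obj N.obj} →
    CellPath (𝟙 _) (𝟙 _) W (under P) → CellPath (𝟙 _) (𝟙 _) W (under P) → Prop
  | here {M L K N : Mod C} (A : Bimod M L) (A' : Bimod L K) (P : HPath (Bimod (C := C)) K N) :
      InnerPair (.cons A (.cons A' P))
        (W := .cons A.pro (.cons L.pro (.cons A'.pro (under P))))
        (.cons A.right (.cons (idc A'.pro) (.ids (under P)) rfl) rfl)
        (.cons (idc A.pro) (.cons A'.left (.ids (under P)) rfl) rfl)
  | there {M L N : Mod C} (A : Bimod M L) {P : HPath (Bimod (C := C)) L N}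
      {W : HPath (Pro (C := C)) L.obj N.obj} {x y : CellPath (𝟙 _) (𝟙 _) W (under P)}
      (h : InnerPair P x y) :
      InnerPair (.cons A P) (W := .cons A.pro W)
        (.cons (idc A.pro) x rfl) (.cons (idc A.pro) y rfl)

/-- The action of the last monoid on the last bimodule of a nonempty string. -/
def rightAct : {M L N : Mod C} → (A : Bimod M L) → (P : HPath (Bimod (C := C)) L N) →
    CellPath (𝟙 _) (𝟙 _) ((under (.cons A P)).append (.one N.pro)) (under (.cons A P))
  | _, _, _, A, .nil _ => .one A.right
  | _, _, _, A, .cons A' P => .cons (idc A.pro) (rightAct A' P) rfl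

/-- Compatibility of a cell with the outer left actions.  For the empty source, the actions of
the source monoid on the target through the two frames agree. -/
def LeftCompat {M' N' : Mod C} (B : Bimod M' N') : {M N : Mod C} →
    (P : HPath (Bimod (C := C)) M N) → (F : MonHom M M') → (G : MonHom N N') →
    Cell F.hom G.hom (under P) B.pro → Prop
  | M, _, .nil _, F, G, φ =>
      comp (P := .one M.pro) (.two F.cell φ rfl) B.left (Category.comp_id _) (Category.comp_id _) =
        comp (P := .one M.pro) (.two φ G.cell rfl) B.right
          (Category.comp_id _) (Category.comp_id _)
  | M, _, .cons A P, F, _, φ =>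
      comp (P := .cons M.pro (under (.cons A P))) (.cons A.left (.ids (under P)) rfl) φ
          (Category.id_comp _) (Category.id_comp _) =
        comp (P := .cons M.pro (under (.cons A P))) (.two F.cell φ rfl) B.left
          (Category.comp_id _) (Category.comp_id _)

/-- Compatibility of a cell with nonempty source with the outer right actions. -/
def RightCompat {M' N' : Mod C} (B : Bimod M' N') : {M N : Mod C} →
    (P : HPath (Bimod (C := C)) M N) → (F : MonHom M M') → (G : MonHom N N') →
    Cell F.hom G.hom (under P) B.pro → Prop
  | _, _, .nil _, _, _, _ => True
  | _, _, .cons A P, _, G, φ =>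
      comp (rightAct A P) φ (Category.id_comp _) (Category.id_comp _) =
        comp (.two φ G.cell rfl) B.right (Category.comp_id _) (Category.comp_id _)

/-- Compatibility of a cell with the actions of the inner monoids. -/
def InnerCompat {M N : Mod C} (P : HPath (Bimod (C := C)) M N) {a b : C} {f : M.obj ⟶ a}
    {g : N.obj ⟶ b} {B : Pro a b} (φ : Cell f g (under P) B) : Prop :=
  ∀ (W : HPath (Pro (C := C)) M.obj N.obj) (x y : CellPath (𝟙 _) (𝟙 _) W (under P)),
    InnerPair P x y → comp x φ (Category.id_comp f) (Category.id_comp g) =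
      comp y φ (Category.id_comp f) (Category.id_comp g)

/-- 2-cells of `Mod`: bimodule homomorphisms. -/
@[ext]
structure BimodHom {M N M' N' : Mod C} (F : MonHom M M') (G : MonHom N N')
    (P : HPath (Bimod (C := C)) M N) (B : Bimod M' N') where
  cell : Cell F.hom G.hom (under P) B.pro
  left : LeftCompat B P F G cell
  right : RightCompat B P F G cell
  inner : InnerCompat P cell

instance : VirtualDoubleGraph (Mod C) where
  Pro := Bimod
  Cell := BimodHom

end Monoids

section ModComp

variable {C : Type u} [Category.{v} C] [VirtualDoubleCategory.{w, z} C]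

/-- The string of underlying cells of a string of bimodule homomorphisms. -/
def underCells {M N M' N' : Mod C} {F : M ⟶ M'} {G : N ⟶ N'} {P : HPath (Bimod (C := C)) M N}
    {Q : HPath (Bimod (C := C)) M' N'} : CellPath F G P Q →
    CellPath (MonHom.hom F) (MonHom.hom G) (under P) (under Q)
  | .nil F => .nil (MonHom.hom F)
  | .cons φ φs hS => .cons (BimodHom.cell φ) (underCells φs) (by rw [hS]; exact under_append _ _)

/-- One-step moves of an inner monoid past an adjacent pair of cells. -/
inductive Move : {M N : Mod C} → (Q : HPath (Bimod (C := C)) M N) → {a b : C} →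
    {f : a ⟶ M.obj} → {g : b ⟶ N.obj} → {W : HPath (Pro (C := C)) a b} →
    CellPath f g W (under Q) → CellPath f g W (under Q) → Prop
  | here {M L K N : Mod C} (B : Bimod M L) (B' : Bimod L K) (Q : HPath (Bimod (C := C)) K N)
      {a b c d e : C} {f : a ⟶ M.obj} {g : b ⟶ L.obj} {h : c ⟶ L.obj} {k : d ⟶ K.obj}
      {l : e ⟶ N.obj} {R : HPath (Pro (C := C)) a b} {S : HPath (Pro (C := C)) b c}
      {T : HPath (Pro (C := C)) c d} {V : HPath (Pro (C := C)) d e}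
      {RS : HPath (Pro (C := C)) a c} {TV : HPath (Pro (C := C)) c e}
      {ST : HPath (Pro (C := C)) b d} {STV : HPath (Pro (C := C)) b e}
      {W : HPath (Pro (C := C)) a e}
      (φ : Cell f g R B.pro) (χ : Cell g h S L.pro) (φ' : Cell h k T B'.pro)
      (y : CellPath k l V (under Q)) (hRS : RS = R.append S) (hTV : TV = T.append V)
      (hST : ST = S.append T) (hSTV : STV = ST.append V) (hx : W = RS.append TV)
      (hy : W = R.append STV) :
      Move (.cons B (.cons B' Q))
        (.cons (comp (.two φ χ hRS) B.right (Category.comp_id _) (Category.comp_id _))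
          (.cons φ' y hTV) hx)
        (.cons φ (.cons (comp (.two χ φ' hST) B'.left (Category.comp_id _) (Category.comp_id _))
          y hSTV) hy)
  | there {M L N : Mod C} (B : Bimod M L) {Q : HPath (Bimod (C := C)) L N}
      {a b c : C} {f : a ⟶ M.obj} {g : b ⟶ L.obj} {h : c ⟶ N.obj}
      {R : HPath (Pro (C := C)) a b} {V : HPath (Pro (C := C)) b c} {W : HPath (Pro (C := C)) a c}
      (φ : Cell f g R B.pro) {x y : CellPath g h V (under Q)} (hxy : Move Q x y)
      (hW : W = R.append V) : Move (.cons B Q) (.cons φ x hW) (.cons φ y hW)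

theorem Move.exists_innerPair {M N : Mod C} {Q : HPath (Bimod (C := C)) M N} {a b : C}
    {f : a ⟶ M.obj} {g : b ⟶ N.obj} {W : HPath (Pro (C := C)) a b}
    {x y : CellPath f g W (under Q)} (h : Move Q x y) :
    ∃ (V : HPath (Pro (C := C)) M.obj N.obj) (p q : CellPath (𝟙 _) (𝟙 _) V (under Q))
      (t : CellPath f g W V), InnerPair Q p q ∧ VComp t p x ∧ VComp t q y := by
  induction h with
  | @here M L K N B B' Q a b c d e f g h k l R S T V RS TV ST STV W φ χ φ' y hRS hTV hST hSTV hx hy =>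
    refine ⟨_, _, _, .cons φ (.cons (S := STV) χ (.cons φ' y hTV) ?_) hy,
      .here B B' Q, ?_, ?_⟩
    · rw [hSTV, hST, hTV, HPath.append_assoc]
    · refine .cons (x₁ := .two φ χ hRS) ?_ _ _ (vcomp_ids (.cons φ' y hTV)) _ _
      exact .cons _ (isAppend_one χ _ _) _ _
    · refine .cons' (isAppend_one φ _ _) (Category.comp_id _) (Category.comp_id _) (comp_idc φ)
        ?_ _ _
      refine .cons (x₁ := .two χ φ' hST) ?_ _ _ (vcomp_ids y) _ _
      exact .cons _ (isAppend_one φ' _ _) _ _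
  | there B φ hxy hW ih =>
    obtain ⟨V, p, q, t, h, h1, h2⟩ := ih
    exact ⟨_, _, _, .cons φ t hW, .there B h,
      .cons' (isAppend_one φ _ _) (Category.comp_id _) (Category.comp_id _) (comp_idc φ) h1 _ _,
      .cons' (isAppend_one φ _ _) (Category.comp_id _) (Category.comp_id _) (comp_idc φ) h2 _ _⟩

/-- The equivalence relation generated by moves. -/
abbrev Moves {M N : Mod C} (Q : HPath (Bimod (C := C)) M N) {a b : C}
    {f : a ⟶ M.obj} {g : b ⟶ N.obj} {W : HPath (Pro (C := C)) a b} :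
    CellPath f g W (under Q) → CellPath f g W (under Q) → Prop :=
  Relation.EqvGen (Move Q)

theorem Moves.comp_eq {M N : Mod C} {Q : HPath (Bimod (C := C)) M N} {a b a' b' : C}
    {f : a ⟶ M.obj} {g : b ⟶ N.obj} {W : HPath (Pro (C := C)) a b}
    {x y : CellPath f g W (under Q)} (h : Moves Q x y) {f' : M.obj ⟶ a'} {g' : N.obj ⟶ b'}
    {B : Pro a' b'} {ψ : Cell f' g' (under Q) B} (hψ : InnerCompat Q ψ) {p : a ⟶ a'} {q : b ⟶ b'}
    (hp : f ≫ f' = p) (hq : g ≫ g' = q) : comp x ψ hp hq = comp y ψ hp hq := by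
  induction h with
  | rel x y h =>
    obtain ⟨V, s, t, r, hst, h1, h2⟩ := h.exists_innerPair
    rw [← assoc ψ h1 (Category.id_comp f') (Category.id_comp g') hp hq,
      ← assoc ψ h2 (Category.id_comp f') (Category.id_comp g') hp hq, hψ _ _ _ hst]
  | refl x => rfl
  | symm x y _ ih => exact ih.symm
  | trans x y z _ _ ih1 ih2 => exact ih1.trans ih2

theorem Moves.cons {M L N : Mod C} (B : Bimod M L) {Q : HPath (Bimod (C := C)) L N}
    {a b c : C} {f : a ⟶ M.obj} {g : b ⟶ L.obj} {h : c ⟶ N.obj}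
    {R : HPath (Pro (C := C)) a b} {V : HPath (Pro (C := C)) b c} {W : HPath (Pro (C := C)) a c}
    (φ : Cell f g R B.pro) {x y : CellPath g h V (under Q)} (hxy : Moves Q x y)
    (hW : W = R.append V) :
    Moves (.cons B Q) (CellPath.cons φ x hW) (CellPath.cons φ y hW) := by
  induction hxy with
  | rel x y h => exact .rel _ _ (.there B φ h hW)
  | refl x => exact .refl _
  | symm x y _ ih => exact .symm _ _ ih
  | trans x y z _ _ ih1 ih2 => exact .trans _ _ _ ih1 ih2

/-- Pushing the first monoid from the left onto the first proarrow. -/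
theorem left_push {K N K' N' : Mod C} {H : K ⟶ K'} {G : N ⟶ N'}
    {P' : HPath (Bimod (C := C)) K N} {Q : HPath (Bimod (C := C)) K' N'}
    (φs : CellPath H G P' Q) :
    ∀ {M M' L : Mod C} {F : M ⟶ M'} {R : HPath (Bimod (C := C)) M K} {B : Bimod M' K'}
      (φ : BimodHom F H R B) (A : Bimod M L) (P : HPath (Bimod (C := C)) L N)
      (hS : HPath.cons A P = R.append P') (T : HPath (Pro (C := C)) M.obj K.obj)
      (hT : T = (HPath.one M.pro).append (under R))
      (hW : HPath.cons M.pro (under (.cons A P)) = T.append (under P')),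
      ∃ x, VComp (P := .cons M.pro (under (.cons A P))) (.cons A.left (.ids (under P)) rfl)
          (underCells (.cons (C := Mod C) φ φs hS)) x ∧
        Moves (.cons B Q) x (.cons (comp (.two (MonHom.cell F) φ.cell hT) B.left
          (Category.comp_id _) (Category.comp_id _)) (underCells φs) hW) := by
  induction φs with
  | nil H =>
    intro M M' L F R B φ A P hS T hT hW
    rw [HPath.append_nil] at hS
    subst hS hT
    refine ⟨_, .cons' (isAppend_nil _) (Category.id_comp _) (Category.id_comp _) φ.left
      (.nil (Category.id_comp _)) _ hW, .refl _⟩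
  | @cons K K₁ N K' K₁' N' H H₁ G R' B' P'' Q S φ' φs hS' ih =>
    intro M M' L F R B φ A P hS T hT hW
    cases R with
    | nil =>
      simp only [HPath.append] at hS
      subst hS
      have hl := φ.left
      simp only [LeftCompat] at hl
      subst hT
      obtain ⟨x, hx, hm⟩ := ih φ' A P hS' _ rfl
        (by rw [HPath.append_assoc, ← under_append, ← hS']; rfl)
      refine ⟨.cons φ.cell x rfl, .cons' (.nil _ _) (Category.id_comp _) (Category.id_comp _)
        (ids_comp φ.cell) hx _ rfl, .trans _ _ _ (Moves.cons B φ.cell hm rfl) (.symm _ _ ?_)⟩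
      have hm' := Move.here B B' Q φ.cell (MonHom.cell H) φ'.cell (underCells φs)
        (RS := .one _) rfl (by rw [hS']; exact under_append _ _) rfl
        (by rw [HPath.append_assoc, ← under_append, ← hS']; rfl) hW rfl
      rw [← hl] at hm'
      exact .rel _ _ hm'
    | cons A₁ R =>
      simp only [HPath.append] at hS
      cases hS
      subst hT
      refine ⟨_, .cons' ?_ (Category.id_comp _) (Category.id_comp _) φ.left
        (ids_vcomp _) _ hW, .refl _⟩
      exact .cons _ (under_append R _ ▸ isAppend_ids _ _) rfl _

theorem IsAppend.source_eq {a b c a' b' c' : C} {f : a ⟶ a'} {g : b ⟶ b'} {h : c ⟶ c'}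
    {P : HPath (Pro (C := C)) a b} {Q : HPath (Pro (C := C)) a' b'}
    {P' : HPath (Pro (C := C)) b c} {Q' : HPath (Pro (C := C)) b' c'}
    {S : HPath (Pro (C := C)) a c} {T : HPath (Pro (C := C)) a' c'}
    {x : CellPath f g P Q} {y : CellPath g h P' Q'} {t : CellPath f h S T}
    (ht : IsAppend x y t) : S = P.append P' := by
  induction ht with
  | nil => rfl
  | cons φ hxyz hx hz ih => rw [hz, ih, hx, HPath.append_assoc]

theorem isAppend_ids_under {M N K : Mod C} (P : HPath (Bimod (C := C)) M N)
    (Q : HPath (Bimod (C := C)) N K) :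
    IsAppend (CellPath.ids (under P)) (CellPath.ids (under Q)) (CellPath.ids (under (P.append Q))) :=
  under_append P Q ▸ isAppend_ids _ _

theorem isAppend_rightAct {M N K L L' : Mod C} (R : HPath (Bimod (C := C)) M K) (A' : Bimod K L')
    (P' : HPath (Bimod (C := C)) L' N) : ∀ (A : Bimod M L) (P : HPath (Bimod (C := C)) L N)
    (_ : HPath.cons A P = R.append (.cons A' P')),
    IsAppend (CellPath.ids (under R)) (rightAct A' P') (rightAct A P) := by
  induction R generalizing L with
  | nil => intro A P h; cases h; exact .nil _ _
  | cons A₁ R ih =>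
    intro A P h
    simp only [HPath.append] at h
    cases h
    cases R with
    | nil => exact .cons _ (ih A' A' P' rfl) _ _
    | cons A₂ R => exact .cons _ (ih A' A₂ _ rfl) _ _

/-- The empty string. -/
def HPath.IsNil {D : Type u} {E : D → D → Type w} : {a b : D} → HPath E a b → Prop
  | _, _, .nil _ => True
  | _, _, .cons _ _ => False

/-- Pushing a monoid to the right end through cells with empty source. -/
theorem nil_push {K N K' N' : Mod C} {H : K ⟶ K'} {G : N ⟶ N'}
    {P' : HPath (Bimod (C := C)) K N} {Q : HPath (Bimod (C := C)) K' N'}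
    (φs : CellPath H G P' Q) (hP : P'.IsNil) :
    ∀ {M M' : Mod C} {F : M ⟶ M'} {R S : HPath (Bimod (C := C)) M _} {B : Bimod M' K'}
      (φ : BimodHom F H R B) (hS : S = R.append P') (T : HPath (Pro (C := C)) M.obj K.obj)
      (hT : T = (under R).append (.one K.pro))
      (hW : (under S).append (.one N.pro) = T.append (under P')),
      ∃ y, VComp ((underCells (.cons (C := Mod C) φ φs hS)).append (.one (MonHom.cell G)))
          (rightAct B Q) y ∧
        Moves (.cons B Q) (.cons (comp (.two φ.cell (MonHom.cell H) hT) B.right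
          (Category.comp_id _) (Category.comp_id _)) (underCells φs) hW) y := by
  induction φs with
  | nil H =>
    intro M M' F R S B φ hS T hT hW
    rw [HPath.append_nil] at hS
    subst hS hT
    refine ⟨_, .cons (isAppend_nil _) (Category.comp_id _) (Category.comp_id _)
      (.nil (Category.comp_id _)) _ hW, .refl _⟩
  | @cons K K₁ N K' K₁' N' H H₁ G R' B' P'' Q S' φ' φs hS' ih =>
    intro M M' F R S B φ hS T hT hW
    cases R' with
    | cons A R' => subst hS'; exact hP.elim
    | nil =>
      simp only [HPath.append] at hS'
      subst hS'
      cases S' with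
      | cons => exact hP.elim
      | nil =>
        obtain ⟨y, hy, hm⟩ := ih trivial φ' rfl (.one _) rfl rfl
        have hl := φ'.left
        simp only [LeftCompat] at hl
        have h0 : (under S).append (.one K.pro) = (under R).append (.one K.pro) := by
          rw [hS, HPath.append_nil]
        refine ⟨.cons φ.cell y h0, .cons' (isAppend_one _ _ _)
          (Category.comp_id _) (Category.comp_id _) (comp_idc φ.cell) hy _ _,
          .trans _ _ _ ?_ (Moves.cons B φ.cell hm h0)⟩
        have hm' := Move.here B B' Q φ.cell (MonHom.cell H) φ'.cell (underCells φs)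
          hT rfl (ST := .one _) rfl rfl hW h0
        rw [hl] at hm'
        exact .rel _ _ hm'

theorem right_push {K N K' N' : Mod C} {H : K ⟶ K'} {G : N ⟶ N'}
    {P' : HPath (Bimod (C := C)) K N} {Q : HPath (Bimod (C := C)) K' N'}
    (φs : CellPath H G P' Q) :
    ∀ {M M' L : Mod C} {F : M ⟶ M'} {R : HPath (Bimod (C := C)) M K} {B : Bimod M' K'}
      (φ : BimodHom F H R B) (A : Bimod M L) (P : HPath (Bimod (C := C)) L N)
      (hS : HPath.cons A P = R.append P'),
      ∃ x y : CellPath (MonHom.hom F) (MonHom.hom G) _ (under (.cons B Q)),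
        VComp (rightAct A P) (underCells (.cons (C := Mod C) φ φs hS)) x ∧
        VComp ((underCells (.cons (C := Mod C) φ φs hS)).append (.one (MonHom.cell G)))
          (rightAct B Q) y ∧ Moves (.cons B Q) x y := by
  have key : ∀ {K K' N N' : Mod C} {H : K ⟶ K'} {G : N ⟶ N'} {P' : HPath (Bimod (C := C)) K N}
      {Q : HPath (Bimod (C := C)) K' N'} (φs : CellPath H G P' Q) (_ : P'.IsNil)
      {M M' L : Mod C} {F : M ⟶ M'} {R : HPath (Bimod (C := C)) M K} {B : Bimod M' K'}
      (φ : BimodHom F H R B) (A : Bimod M L) (P : HPath (Bimod (C := C)) L N)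
      (hS : HPath.cons A P = R.append P'),
      ∃ x y : CellPath (MonHom.hom F) (MonHom.hom G) _ (under (.cons B Q)),
        VComp (rightAct A P) (underCells (.cons (C := Mod C) φ φs hS)) x ∧
        VComp ((underCells (.cons (C := Mod C) φ φs hS)).append (.one (MonHom.cell G)))
          (rightAct B Q) y ∧ Moves (.cons B Q) x y := by
    intro K K' N N' H G P' Q φs hP M M' L F R B φ A P hS
    cases P' with
    | cons => exact hP.elim
    | nil =>
      have hR : R = .cons A P := by rw [hS, HPath.append_nil]
      subst hR
      have h0 : (under (HPath.cons A P)).append (.one K.pro) =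
        ((under (HPath.cons A P)).append (.one K.pro)).append (.nil _) :=
        (HPath.append_nil _).symm
      obtain ⟨y, hy, hm⟩ := nil_push φs trivial φ hS _ rfl h0
      exact ⟨_, y, .cons' (isAppend_nil _) (Category.id_comp _) (Category.id_comp _) φ.right
        (ids_vcomp _) _ h0, hy, hm⟩
  induction φs with
  | nil H => exact key (.nil H) trivial
  | @cons K K₁ N K' K₁' N' H H₁ G R' B' P'' Q S' φ' φs hS' ih =>
    intro M M' L F R B φ A P hS
    cases S' with
    | nil => exact key (.cons φ' φs hS') trivial φ A P hS
    | cons A' P₁ =>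
      obtain ⟨x, y, hx, hy, hm⟩ := ih φ' A' P₁ hS'
      have h0 : (under (HPath.cons A P)).append (.one N.pro) =
          (under R).append ((under (HPath.cons A' P₁)).append (.one N.pro)) := by
        rw [hS, under_append, HPath.append_assoc]
      exact ⟨.cons φ.cell x h0, .cons φ.cell y h0,
        .cons' (isAppend_rightAct R A' P₁ A P hS) (Category.id_comp _) (Category.id_comp _)
          (ids_comp φ.cell) hx _ _,
        .cons' (isAppend_one _ _ _) (Category.comp_id _) (Category.comp_id _) (comp_idc φ.cell)
          hy _ _, Moves.cons B φ.cell hm h0⟩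

theorem InnerPair.split {M N K : Mod C} (R : HPath (Bimod (C := C)) M K)
    (P' : HPath (Bimod (C := C)) K N) : ∀ {S : HPath (Bimod (C := C)) M N}
    {W : HPath (Pro (C := C)) M.obj N.obj} {p q : CellPath (𝟙 _) (𝟙 _) W (under S)}
    (_ : InnerPair S p q) (_ : S = R.append P'),
    (∃ (V : HPath (Pro (C := C)) M.obj K.obj) (p' q' : CellPath (𝟙 _) (𝟙 _) V (under R)),
      InnerPair R p' q' ∧ IsAppend p' (.ids (under P')) p ∧ IsAppend q' (.ids (under P')) q) ∨
    (∃ (V : HPath (Pro (C := C)) K.obj N.obj) (p' q' : CellPath (𝟙 _) (𝟙 _) V (under P')),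
      InnerPair P' p' q' ∧ IsAppend (.ids (under R)) p' p ∧ IsAppend (.ids (under R)) q' q) ∨
    (∃ (L L' : Mod C) (A : Bimod M L) (R₀ : HPath (Bimod (C := C)) L K) (A' : Bimod K L')
      (P₀ : HPath (Bimod (C := C)) L' N) (_ : R = .cons A R₀) (_ : P' = .cons A' P₀),
      IsAppend (rightAct A R₀) (.ids (under P')) p ∧
      IsAppend (P' := .cons K.pro (under (.cons A' P₀))) (.ids (under R))
        (.cons A'.left (.ids (under P₀)) rfl) q) := by
  induction R with
  | nil => 
    intro S W p q h hS
    simp only [HPath.append] at hS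
    subst hS
    exact .inr (.inl ⟨_, p, q, h, .nil _ _, .nil _ _⟩)
  | cons A R ih =>
    intro S W p q h hS
    simp only [HPath.append] at hS
    cases h with
    | here A₁ A₂ P₂ =>
      cases R with
      | nil =>
        simp only [HPath.append] at hS
        cases hS
        refine .inr (.inr ⟨_, _, A, .nil _, A₂, P₂, rfl, rfl, ?_, ?_⟩)
        · exact isAppend_one _ _ _
        · exact isAppend_one _ _ _
      | cons A₃ R =>
        simp only [HPath.append] at hS
        cases hS
        refine .inl ⟨_, _, _, .here A A₂ R, ?_, ?_⟩
        · exact .cons _ (.cons _ (isAppend_ids_under _ _) _ _) _ _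
        · exact .cons _ (.cons _ (isAppend_ids_under _ _) _ _) _ _
    | there A₁ h =>
      cases hS
      rcases ih P' h rfl with ⟨V, p', q', h, hp, hq⟩ | ⟨V, p', q', h, hp, hq⟩ |
        ⟨L, L', A₁, R₀, A', P₀, hR, hP, hp, hq⟩
      · exact .inl ⟨_, _, _, .there A h, .cons _ hp _ _, .cons _ hq _ _⟩
      · exact .inr (.inl ⟨_, _, _, h, .cons _ hp _ _, .cons _ hq _ _⟩)
      · subst hR
        exact .inr (.inr ⟨_, _, A, _, A', P₀, rfl, hP, .cons _ hp _ _, .cons _ hq _ _⟩)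

theorem inner_push {M N M' N' : Mod C} {F : M ⟶ M'} {G : N ⟶ N'}
    {S : HPath (Bimod (C := C)) M N} {Q : HPath (Bimod (C := C)) M' N'}
    (φs : CellPath F G S Q) :
    ∀ {W : HPath (Pro (C := C)) M.obj N.obj} {p q : CellPath (𝟙 _) (𝟙 _) W (under S)}
    (_ : InnerPair S p q), ∃ x y : CellPath (MonHom.hom F) (MonHom.hom G) W (under Q),
      VComp p (underCells φs) x ∧ VComp q (underCells φs) y ∧ Moves Q x y := by
  induction φs with
  | nil F => intro W p q h; cases h
  | @cons M K N M' K' N' F H G R B P' Q S φ φs hS ih =>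
    intro W p q h
    rcases h.split R P' hS with ⟨V, p', q', h, hp, hq⟩ | ⟨V, p', q', h, hp, hq⟩ |
        ⟨L, L', A, R₀, A', P₀, hR, hP, hp, hq⟩
    · refine ⟨_, _, .cons' hp (Category.id_comp _) (Category.id_comp _) (φ.inner _ _ _ h)
        (ids_vcomp _) _ hp.source_eq, .cons hq (Category.id_comp _) (Category.id_comp _)
        (ids_vcomp _) _ hp.source_eq, .refl _⟩
    · obtain ⟨x, y, hx, hy, hm⟩ := ih h
      exact ⟨_, _, .cons' hp (Category.id_comp _) (Category.id_comp _) (ids_comp φ.cell) hx _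
        hp.source_eq, .cons' hq (Category.id_comp _) (Category.id_comp _) (ids_comp φ.cell) hy _
        hp.source_eq, Moves.cons B φ.cell hm _⟩
    · subst hR hP
      cases φs with
      | @cons _ K₁ _ _ K₁' _ _ H₁ _ R' B' P'' Q _ φ' φs hS' =>
        obtain ⟨x, hx, hm⟩ := left_push φs φ' A' P₀ hS' _ rfl
          (by rw [HPath.append_assoc, ← under_append, ← hS']; rfl)
        refine ⟨_, _, .cons' hp (Category.id_comp _) (Category.id_comp _) φ.right
          (ids_vcomp _) _ hp.source_eq, .cons' hq (Category.id_comp _) (Category.id_comp _)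
          (ids_comp φ.cell) hx _ hq.source_eq,
          .trans _ _ _ ?_ (.symm _ _ (Moves.cons B φ.cell hm _))⟩
        exact .rel _ _ (Move.here B B' Q φ.cell (MonHom.cell H) φ'.cell (underCells φs)
          rfl (by rw [hS']; exact under_append _ _) rfl
          (by rw [HPath.append_assoc, ← under_append, ← hS']; rfl) _ _)

theorem hom_comp_eq {M N K : Mod C} {F : M ⟶ N} {G : N ⟶ K} {H : M ⟶ K} (h : F ≫ G = H) :
    MonHom.hom F ≫ MonHom.hom G = MonHom.hom H := by
  subst h; rfl

theorem cell_comp_eq {M N K : Mod C} {F : M ⟶ N} {G : N ⟶ K} {H : M ⟶ K} (h : F ≫ G = H) :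
    comp (.one (MonHom.cell F)) (MonHom.cell G) (hom_comp_eq h) (hom_comp_eq h) =
      MonHom.cell H := by
  subst h; rfl

theorem left_target {M K N M' K' N' M'' N'' : Mod C} {F : M ⟶ M'} {H : K ⟶ K'} {G : N ⟶ N'}
    {F' : M' ⟶ M''} {G' : N' ⟶ N''} {U : M ⟶ M''} {V : N ⟶ N''}
    {R : HPath (Bimod (C := C)) M K} {B' : Bimod M' K'} {P' : HPath (Bimod (C := C)) K N}
    {Q : HPath (Bimod (C := C)) K' N'} {S : HPath (Bimod (C := C)) M N} {B : Bimod M'' N''}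
    (φ : BimodHom F H R B') (φs : CellPath H G P' Q) (hS : S = R.append P')
    (ψ : BimodHom F' G' (.cons B' Q) B) (hU : F ≫ F' = U) (hV : G ≫ G' = V)
    {W : HPath (Pro (C := C)) M.obj N.obj} (hW : W = (HPath.one M.pro).append (under S))
    {T : HPath (Pro (C := C)) M.obj K.obj} (hT : T = (HPath.one M.pro).append (under R))
    (hW' : W = T.append (under P')) :
    comp (.two (MonHom.cell U) (comp (underCells (.cons (C := Mod C) φ φs hS)) ψ.cell
      (hom_comp_eq hU) (hom_comp_eq hV)) hW) B.left (Category.comp_id _) (Category.comp_id _) =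
    comp (.cons (comp (.two (MonHom.cell F) φ.cell hT) B'.left (Category.comp_id _)
      (Category.comp_id _)) (underCells φs) hW') ψ.cell (hom_comp_eq hU) (hom_comp_eq hV) := by
  have h1 := assoc B.left (vcomp_two
    (isAppend_one (MonHom.cell F) (underCells (.cons (C := Mod C) φ φs hS)) hW)
    (hom_comp_eq hU) (hom_comp_eq hU) (hom_comp_eq hV) (cell_comp_eq hU) (ω := comp _ ψ.cell _ _) rfl
    rfl hW)
    (Category.comp_id _) (Category.comp_id _) (hom_comp_eq hU) (hom_comp_eq hV)
    (Category.comp_id _) (Category.comp_id _)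
  have h2 := assoc (p := MonHom.hom U) (q := MonHom.hom V) ψ.cell
    (VComp.cons (x := .cons (MonHom.cell F) (underCells (.cons (C := Mod C) φ φs hS)) hW)
    (φ := B'.left) (x₁ := .two (MonHom.cell F) φ.cell hT) (x₂ := underCells φs)
    (.cons _ (isAppend_one _ _ _) _ _) (Category.comp_id _) (Category.comp_id _)
    (vcomp_ids _) rfl hW') (Category.id_comp _) (Category.id_comp _) (hom_comp_eq hU)
    (hom_comp_eq hV) (hom_comp_eq hU) (hom_comp_eq hV)
  exact h1.symm.trans ((congrArg (fun t => comp _ t _ _) ψ.left.symm).trans h2)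

theorem right_target {M N M' K' N' M'' N'' : Mod C} {F : M ⟶ M'} {G : N ⟶ N'}
    {F' : M' ⟶ M''} {G' : N' ⟶ N''} {U : M ⟶ M''} {V : N ⟶ N''}
    {B' : Bimod M' K'} {Q : HPath (Bimod (C := C)) K' N'} {S : HPath (Bimod (C := C)) M N}
    {B : Bimod M'' N''} (φs : CellPath F G S (.cons B' Q))
    (ψ : BimodHom F' G' (.cons B' Q) B) (hU : F ≫ F' = U) (hV : G ≫ G' = V)
    {y : CellPath (MonHom.hom F) (MonHom.hom G) _ (under (.cons B' Q))}
    (hy : VComp ((underCells φs).append (.one (MonHom.cell G))) (rightAct B' Q) y) :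
    comp (.two (comp (underCells φs) ψ.cell (hom_comp_eq hU) (hom_comp_eq hV)) (MonHom.cell V)
      rfl) B.right (Category.comp_id _) (Category.comp_id _) =
    comp y ψ.cell (hom_comp_eq hU) (hom_comp_eq hV) := by
  have h1 := assoc B.right (vcomp_two
    (isAppend_append (underCells φs) (.one (MonHom.cell G)))
    (hom_comp_eq hU) (hom_comp_eq hV) (hom_comp_eq hV) (χ := comp _ ψ.cell _ _) rfl
    (cell_comp_eq hV) rfl rfl)
    (Category.comp_id _) (Category.comp_id _) (hom_comp_eq hU) (hom_comp_eq hV)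
    (Category.comp_id _) (Category.comp_id _)
  have h2 := assoc (p := MonHom.hom U) (q := MonHom.hom V) ψ.cell hy
    (Category.id_comp _) (Category.id_comp _) (hom_comp_eq hU)
    (hom_comp_eq hV) (hom_comp_eq hU) (hom_comp_eq hV)
  exact h1.symm.trans ((congrArg (fun t => comp _ t _ _) ψ.right.symm).trans h2)

/-- Composition of 2-cells in `Mod`. -/
def BimodHom.comp {M N M' N' M'' N'' : Mod C} {F : M ⟶ M'} {G : N ⟶ N'} {F' : M' ⟶ M''}
    {G' : N' ⟶ N''} {U : M ⟶ M''} {V : N ⟶ N''} {P : HPath (Bimod (C := C)) M N}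
    {Q : HPath (Bimod (C := C)) M' N'} {B : Bimod M'' N''} (φs : CellPath F G P Q)
    (ψ : BimodHom F' G' Q B) (hU : F ≫ F' = U) (hV : G ≫ G' = V) : BimodHom U V P B where
  cell := VirtualDoubleStruct.comp (underCells φs) ψ.cell (hom_comp_eq hU) (hom_comp_eq hV)
  left := by
    cases φs with
    | nil =>
      have h1 := assoc (p := MonHom.hom U) (q := MonHom.hom V) B.left (vcomp_two
        (isAppend_one (MonHom.cell F) (.nil (MonHom.hom F)) rfl)
        (hom_comp_eq hU) (hom_comp_eq hU) (hom_comp_eq hV) (cell_comp_eq hU)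
        (ψ := ψ.cell) rfl rfl rfl)
        (Category.comp_id _) (Category.comp_id _) (hom_comp_eq hU) (hom_comp_eq hV)
        (Category.comp_id _) (Category.comp_id _)
      have h2 := assoc (p := MonHom.hom U) (q := MonHom.hom V) B.right (vcomp_two
        (IsAppend.nil (MonHom.hom F) (.one (MonHom.cell F)))
        (hom_comp_eq hU) (hom_comp_eq hV) (hom_comp_eq hV) (φ := ψ.cell) rfl
        (cell_comp_eq hV) rfl rfl)
        (Category.comp_id _) (Category.comp_id _) (hom_comp_eq hU) (hom_comp_eq hV)
        (Category.comp_id _) (Category.comp_id _)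
      exact h1.symm.trans ((congrArg (fun t => VirtualDoubleStruct.comp _ t _ _) ψ.left).trans h2)
    | @cons M K N M' K' N' F H G R B' P' Q _ φ φs hS =>
      cases P with
      | nil =>
        cases R with
        | cons => simp only [HPath.append] at hS; cases hS
        | nil =>
          simp only [HPath.append] at hS
          subst hS
          have hl := φ.left
          simp only [LeftCompat] at hl
          obtain ⟨y, hy, hm⟩ := nil_push φs trivial φ rfl (.one _) rfl rfl
          refine (left_target φ φs rfl ψ hU hV rfl (T := .one _) rfl rfl).trans
            (.trans ?_ (right_target (.cons φ φs rfl) ψ hU hV hy).symm)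
          rw [hl]
          exact hm.comp_eq ψ.inner _ _
      | cons A P =>
        have hW : HPath.cons M.pro (under (.cons A P)) =
            ((HPath.one M.pro).append (under R)).append (under P') := by
          rw [HPath.append_assoc, ← under_append, ← hS]; rfl
        obtain ⟨x, hx, hm⟩ := left_push φs φ A P hS _ rfl hW
        exact (assoc ψ.cell hx _ _ _ _ _ _).trans ((hm.comp_eq ψ.inner _ _).trans
          (left_target φ φs hS ψ hU hV rfl rfl hW).symm)
  right := by
    cases P with
    | nil => trivial
    | cons A P =>
      cases φs with
      | cons φ φs hS =>
        obtain ⟨x, y, hx, hy, hm⟩ := right_push φs φ A P hS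
        exact (assoc ψ.cell hx _ _ _ _ _ _).trans ((hm.comp_eq ψ.inner _ _).trans
          (right_target (.cons φ φs hS) ψ hU hV hy).symm)
  inner := by
    intro W x y h
    obtain ⟨x', y', hx, hy, hm⟩ := inner_push φs h
    exact (assoc ψ.cell hx _ _ _ _ _ _).trans ((hm.comp_eq ψ.inner (hom_comp_eq hU)
      (hom_comp_eq hV)).trans (assoc ψ.cell hy _ _ _ _ _ _).symm)

/-- Identity 2-cells in `Mod`. -/
def BimodHom.id {M N : Mod C} (A : Bimod M N) : BimodHom (𝟙 M) (𝟙 N) (.one A) A where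
  cell := idc A.pro
  left := (comp_idc A.left).trans (ids_comp A.left).symm
  right := (comp_idc A.right).trans (ids_comp A.right).symm
  inner := by
    intro W x y h
    cases h with
    | there A h => cases h

instance : VirtualDoubleStruct (Mod C) where
  idc := BimodHom.id
  comp := BimodHom.comp

theorem underCells_ids {M N : Mod C} (P : HPath (Bimod (C := C)) M N) :
    underCells (CellPath.ids (C := Mod C) P) = CellPath.ids (under P) := by
  induction P with
  | nil => rfl
  | cons A P ih => exact congrArg (fun t => CellPath.cons (idc A.pro) t rfl) ih

theorem isAppend_underCells {M N K M' N' K' : Mod C} {F : M ⟶ M'} {G : N ⟶ N'} {H : K ⟶ K'}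
    {P : HPath (Bimod (C := C)) M N} {Q : HPath (Bimod (C := C)) M' N'}
    {P' : HPath (Bimod (C := C)) N K} {Q' : HPath (Bimod (C := C)) N' K'}
    {S : HPath (Bimod (C := C)) M K} {T : HPath (Bimod (C := C)) M' K'}
    {x : CellPath F G P Q} {y : CellPath G H P' Q'} {t : CellPath F H S T}
    (h : IsAppend x y t) : IsAppend (underCells x) (underCells y) (underCells t) := by
  induction h with
  | nil => exact .nil _ _
  | cons φ _ hx hz ih => exact .cons _ ih _ _

theorem vcomp_underCells {M N M' N' M'' N'' : Mod C} {F : M ⟶ M'} {G : N ⟶ N'} {F' : M' ⟶ M''}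
    {G' : N' ⟶ N''} {U : M ⟶ M''} {V : N ⟶ N''} {P : HPath (Bimod (C := C)) M N}
    {Q : HPath (Bimod (C := C)) M' N'} {R : HPath (Bimod (C := C)) M'' N''}
    {x : CellPath F G P Q} {y : CellPath F' G' Q R} {t : CellPath U V P R}
    (h : VComp x y t) : VComp (underCells x) (underCells y) (underCells t) := by
  induction h with
  | nil h => exact .nil (hom_comp_eq h)
  | cons hx hu hv hz hQ hP ih =>
    exact .cons (isAppend_underCells hx) (hom_comp_eq hu) (hom_comp_eq hv) ih _ _

/-- The virtual double category of monoids and modules. -/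
instance : VirtualDoubleCategory (Mod C) where
  ids_comp φ := by
    refine BimodHom.ext (.trans ?_ (ids_comp (BimodHom.cell φ)))
    exact congrArg (fun t => comp t _ _ _) (underCells_ids _)
  comp_idc φ := BimodHom.ext (comp_idc (BimodHom.cell φ))
  assoc ψ h hs ht hp hq hp' hq' := BimodHom.ext
    (assoc (BimodHom.cell ψ) (vcomp_underCells h) (hom_comp_eq hs) (hom_comp_eq ht)
      (hom_comp_eq hp) (hom_comp_eq hq) (hom_comp_eq hp') (hom_comp_eq hq'))

end ModComp

section Equipment

variable {C : Type u} [Category.{v} C] [VirtualDoubleCategory.{w, z} C]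

/-- Opcartesian cells: composition with `ω` induces bijections
`_f C_g(R, Q, S; T) ≅ _f C_g(R, P, S; T)`. -/
def IsOpcartesian {a b : C} {P : HPath (Pro (C := C)) a b} {Q : Pro a b}
    (ω : Cell (𝟙 a) (𝟙 b) P Q) : Prop :=
  ∀ ⦃a' b' x y : C⦄ (R : HPath (Pro (C := C)) a' a) (S : HPath (Pro (C := C)) b b')
    (f : a' ⟶ x) (g : b' ⟶ y) (T : Pro x y) (χ : Cell f g (R.append (P.append S)) T),
    ∃! ψ : Cell f g (R.append (.cons Q S)) T,
      comp ((CellPath.ids R).append (.cons ω (.ids S) rfl)) ψ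
        (Category.id_comp f) (Category.id_comp g) = χ

/-- Cartesian cells: composition with `κ` induces bijections
`_h C_k(R; P) ≅ _{fh} C_{gk}(R; Q)`. -/
def IsCartesian {a b a' b' : C} {f : a ⟶ a'} {g : b ⟶ b'} {P : Pro a b} {Q : Pro a' b'}
    (κ : Cell f g (.one P) Q) : Prop :=
  ∀ ⦃c d : C⦄ (h : c ⟶ a) (k : d ⟶ b) (R : HPath (Pro (C := C)) c d)
    (χ : Cell (h ≫ f) (k ≫ g) R Q), ∃! ψ : Cell h k R P, comp (.one ψ) κ rfl rfl = χ

/-- Invertible 2-cells. -/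
def IsIsoCell {a b a' b' : C} {f : a ⟶ a'} {g : b ⟶ b'} {P : Pro a b} {Q : Pro a' b'}
    (φ : Cell f g (.one P) Q) : Prop :=
  ∃ (f' : a' ⟶ a) (g' : b' ⟶ b) (ψ : Cell f' g' (.one Q) P) (hf : f ≫ f' = 𝟙 a)
    (hg : g ≫ g' = 𝟙 b) (hf' : f' ≫ f = 𝟙 a') (hg' : g' ≫ g = 𝟙 b'),
    comp (.one φ) ψ hf hg = idc P ∧ comp (.one ψ) φ hf' hg' = idc Q

/-- A unit of the object `c`. -/
structure UnitOf (c : C) where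
  pro : Pro c c
  cell : Cell (𝟙 c) (𝟙 c) (.nil c) pro
  opcartesian : IsOpcartesian cell

variable (C) in
/-- A choice of a unit of each object. -/
structure Units where
  unit : (c : C) → UnitOf c

variable (C) in
/-- A virtual equipment is a virtual double category that has units and restrictions. -/
structure IsVirtualEquipment : Prop where
  has_units : ∀ c : C, Nonempty (UnitOf c)
  has_restrictions : ∀ {a b a' b' : C} (f : a ⟶ a') (g : b ⟶ b') (Q : Pro a' b'),
    ∃ (P : Pro a b) (κ : Cell f g (.one P) Q), IsCartesian κ

theorem UnitOf.ext_left {c d : C} (η : UnitOf c) {S : HPath (Pro (C := C)) c d} {x y : C}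
    {f : c ⟶ x} {g : d ⟶ y} {T : Pro x y} {ψ ψ' : Cell f g (.cons η.pro S) T}
    (h : comp (P := S) (.cons η.cell (.ids S) rfl) ψ (Category.id_comp f) (Category.id_comp g) =
      comp (P := S) (.cons η.cell (.ids S) rfl) ψ' (Category.id_comp f) (Category.id_comp g)) :
    ψ = ψ' :=
  (η.opcartesian (.nil c) S f g T _).unique h rfl

theorem UnitOf.ext_right {c d : C} (η : UnitOf d) {R : HPath (Pro (C := C)) c d} {x y : C}
    {f : c ⟶ x} {g : d ⟶ y} {T : Pro x y} {ψ ψ' : Cell f g (R.append (.one η.pro)) T}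
    (h : comp ((CellPath.ids R).append (.cons η.cell (.nil _) rfl)) ψ
        (Category.id_comp f) (Category.id_comp g) =
      comp ((CellPath.ids R).append (.cons η.cell (.nil _) rfl)) ψ'
        (Category.id_comp f) (Category.id_comp g)) : ψ = ψ' :=
  (η.opcartesian R (.nil d) f g T _).unique h rfl

/-- The left action of a unit on a proarrow, determined by `unit_actL`. -/
noncomputable def UnitOf.actL {c d : C} (η : UnitOf c) (P : Pro c d) :
    Cell (𝟙 c) (𝟙 d) (.cons η.pro (.one P)) P :=
  (η.opcartesian (.nil c) (.one P) (𝟙 c) (𝟙 d) P (idc P)).choose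

theorem UnitOf.unit_actL {c d : C} (η : UnitOf c) (P : Pro c d) :
    comp (P := .one P) (.two η.cell (idc P) rfl) (η.actL P)
      (Category.id_comp _) (Category.id_comp _) = idc P :=
  (η.opcartesian (.nil c) (.one P) (𝟙 c) (𝟙 d) P (idc P)).choose_spec.1

/-- The right action of a unit on a proarrow, determined by `unit_actR`. -/
noncomputable def UnitOf.actR {c d : C} (η : UnitOf d) (P : Pro c d) :
    Cell (𝟙 c) (𝟙 d) (.cons P (.one η.pro)) P :=
  (η.opcartesian (.one P) (.nil d) (𝟙 c) (𝟙 d) P (idc P)).choose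

theorem UnitOf.unit_actR {c d : C} (η : UnitOf d) (P : Pro c d) :
    comp (P := .one P) (.two (idc P) η.cell rfl) (η.actR P)
      (Category.id_comp _) (Category.id_comp _) = idc P :=
  (η.opcartesian (.one P) (.nil d) (𝟙 c) (𝟙 d) P (idc P)).choose_spec.1

/-- Composing with a nullary cell on the left, and then acting by the unit. -/
theorem UnitOf.two_actL {c d a b : C} (η : UnitOf c) (P : Pro c d) {f : a ⟶ c} {g : b ⟶ d}
    {R : HPath (Pro (C := C)) a b} (φ : Cell f g R P) {χ : Cell f f (.nil a) η.pro}
    (hχ : comp (.nil f) η.cell (Category.comp_id f) (Category.comp_id f) = χ) :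
    comp (.two χ φ rfl) (η.actL P) (Category.comp_id f) (Category.comp_id g) = φ := by
  have h := assoc (η.actL P) (vcomp_two (IsAppend.nil f (.one φ)) (Category.comp_id f)
    (Category.comp_id f) (Category.comp_id g) hχ (comp_idc φ) (by rfl) (by rfl))
    (Category.id_comp _) (Category.id_comp _) (Category.comp_id f) (Category.comp_id g)
    (Category.comp_id f) (Category.comp_id g)
  exact h.symm.trans ((congrArg (fun t => comp _ t _ _) (η.unit_actL P)).trans (comp_idc φ))

theorem UnitOf.two_actR {c d a b : C} (η : UnitOf d) (P : Pro c d) {f : a ⟶ c} {g : b ⟶ d}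
    {R : HPath (Pro (C := C)) a b} (φ : Cell f g R P) {χ : Cell g g (.nil b) η.pro}
    (hχ : comp (.nil g) η.cell (Category.comp_id g) (Category.comp_id g) = χ) :
    comp (.two φ χ R.append_nil.symm) (η.actR P) (Category.comp_id f) (Category.comp_id g) = φ := by
  have h := assoc (η.actR P) (vcomp_two (isAppend_nil (.one φ)) (Category.comp_id f)
    (Category.comp_id g) (Category.comp_id g) (comp_idc φ) hχ (by rfl) R.append_nil.symm)
    (Category.id_comp _) (Category.id_comp _) (Category.comp_id f) (Category.comp_id g)
    (Category.comp_id f) (Category.comp_id g)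
  exact h.symm.trans ((congrArg (fun t => comp _ t _ _) (η.unit_actR P)).trans (comp_idc φ))

theorem UnitOf.nil_cell {c : C} (η : UnitOf c) :
    comp (.nil (𝟙 c)) η.cell (Category.comp_id _) (Category.comp_id _) = η.cell :=
  ids_comp η.cell

/-- A left action by a unit absorbs an inserted unit cell. -/
theorem UnitOf.insert_left {c d e : C} (η : UnitOf c) {S : HPath (Pro (C := C)) c d} {B : Pro c e}
    {g : d ⟶ e} (r : Cell (𝟙 c) g S B) :
    comp (P := S) (.cons η.cell (.ids S) rfl) (comp (P := .cons η.pro S) (.two (idc η.pro) r rfl)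
      (η.actL B) (Category.id_comp _) (Category.comp_id g)) (Category.id_comp _)
      (Category.id_comp _) = r := by
  refine (assoc (η.actL B) (vcomp_two (isAppend_one η.cell (.ids S) rfl) (Category.id_comp _)
    (Category.id_comp _) (Category.id_comp _) (comp_idc η.cell) (ids_comp r) rfl rfl) _ _ _ _
    (Category.id_comp _) (Category.comp_id _)).trans ?_
  exact η.two_actL B r η.nil_cell

theorem UnitOf.mul_one {c : C} (η : UnitOf c) :
    comp (P := .one η.pro) (.two (idc η.pro) η.cell rfl) (η.actL η.pro)
      (Category.id_comp _) (Category.id_comp _) = idc η.pro := by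
  apply η.ext_left
  refine (η.insert_left (S := .nil c) η.cell).trans ?_
  exact (comp_idc η.cell).symm

theorem UnitOf.actR_self {c : C} (η : UnitOf c) : η.actR η.pro = η.actL η.pro :=
  η.ext_right (R := .one η.pro) ((η.unit_actR η.pro).trans η.mul_one.symm)

/-- Inserting a unit cell at the left, next to an inner left action of the unit. -/
theorem UnitOf.insert_actL {c d e : C} (η : UnitOf c) (A : Pro c d) (A' : Pro d e) {B : Pro c e}
    (r : Cell (𝟙 c) (𝟙 e) (.cons A (.one A')) B) :
    comp (P := .cons A (.one A')) (.cons η.cell (.ids (.cons A (.one A'))) rfl)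
      (comp (P := .cons η.pro (.cons A (.one A'))) (.two (η.actL A) (idc A') rfl) r
        (Category.id_comp _) (Category.id_comp _)) (Category.id_comp _) (Category.id_comp _) =
      r := by
  refine (assoc r (vcomp_two (x₁ := .two η.cell (idc A) rfl) (x₂ := .one (idc A'))
    (.cons _ (isAppend_one _ _ _) _ _) (Category.id_comp _) (Category.id_comp _)
    (Category.id_comp _) (η.unit_actL A) (comp_idc (idc A')) rfl rfl) _ _ _ _
    (Category.id_comp _) (Category.id_comp _)).trans ?_
  exact ids_comp r

/-- The trivial monoid on an object, for a given unit. -/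
@[reducible]
noncomputable def UnitOf.trivialOn {c : C} (η : UnitOf c) : MonoidOn c where
  pro := η.pro
  one := η.cell
  mul := η.actL η.pro
  one_mul := η.unit_actL η.pro
  mul_one := η.mul_one
  mul_assoc := η.ext_left ((η.insert_actL _ _ _).trans (η.insert_left _).symm)

variable (U : Units C)

/-- The trivial monoid on an object. -/
@[reducible]
noncomputable def Units.trivial (x : C) : Mod C := ⟨x, (U.unit x).trivialOn⟩

/-- The unit 2-cell on a vertical arrow, determined by `unit_map`. -/
noncomputable def UnitOf.map {x y : C} (η : UnitOf x) (θ : UnitOf y) (k : x ⟶ y) :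
    Cell k k (.one η.pro) θ.pro :=
  (η.opcartesian (.nil x) (.nil x) k k θ.pro
    (comp (.nil k) θ.cell (Category.comp_id k) (Category.comp_id k))).choose

theorem UnitOf.unit_map {x y : C} (η : UnitOf x) (θ : UnitOf y) (k : x ⟶ y) :
    comp (.one η.cell) (η.map θ k) (Category.id_comp k) (Category.id_comp k) =
      comp (.nil k) θ.cell (Category.comp_id k) (Category.comp_id k) :=
  (η.opcartesian (.nil x) (.nil x) k k θ.pro
    (comp (.nil k) θ.cell (Category.comp_id k) (Category.comp_id k))).choose_spec.1

/-- The homomorphism of trivial monoids induced by a vertical arrow. -/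
@[reducible]
noncomputable def Units.trivialHom {x y : C} (k : x ⟶ y) : MonHom (U.trivial x) (U.trivial y) where
  hom := k
  cell := (U.unit x).map (U.unit y) k
  map_one := (U.unit x).unit_map (U.unit y) k
  map_mul := by
    apply (U.unit x).ext_left
    refine (assoc _ (vcomp_one _ _ (Category.id_comp _) (Category.id_comp _)) _ _ _ _
      (Category.id_comp k) (Category.id_comp k)).trans ?_
    refine .trans ?_ (assoc _ (vcomp_two (isAppend_one _ _ _) (Category.id_comp k)
      (Category.id_comp k) (Category.id_comp k) ((U.unit x).unit_map (U.unit y) k)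
      (ids_comp _) rfl rfl) _ _ _ _
      (Category.comp_id k) (Category.comp_id k)).symm
    refine .trans ?_ ((U.unit y).two_actL _ _ rfl).symm
    refine .trans ?_ (ids_comp _)
    exact congrArg (fun t => comp (.one t) _ _ _) ((U.unit x).unit_actL (U.unit x).pro)

/-- A proarrow, regarded as a bimodule between the trivial monoids on its ends. -/
@[reducible]
noncomputable def Units.trivialBimod {x y : C} (P : Pro x y) :
    Bimod (U.trivial x) (U.trivial y) where
  pro := P
  left := (U.unit x).actL P
  right := (U.unit y).actR P
  one_left := (U.unit x).unit_actL P
  mul_left := (U.unit x).ext_left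
    (((U.unit x).insert_actL _ _ _).trans ((U.unit x).insert_left _).symm)
  right_one := (U.unit y).unit_actR P
  right_mul := by
    refine (U.unit y).ext_right (R := .cons P (.one (U.unit y).pro)) ?_
    refine (assoc ((U.unit y).actR P) (vcomp_two (x₁ := .one (idc P))
      (x₂ := .two (idc (U.unit y).pro) (U.unit y).cell rfl)
      (isAppend_one _ _ _) (Category.id_comp _) (Category.id_comp _)
      (Category.id_comp _) (comp_idc (idc P)) (U.unit y).mul_one rfl rfl) _ _ _ _
      (Category.id_comp _) (Category.id_comp _)).trans ?_
    refine (ids_comp ((U.unit y).actR P)).trans (.symm ?_)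
    refine (assoc ((U.unit y).actR P) (vcomp_two (x₁ := .ids _)
      (x₂ := .one (U.unit y).cell)
      (isAppend_append (.ids (.cons P (.one (U.unit y).pro))) (.one (U.unit y).cell))
      (Category.id_comp _) (Category.id_comp _)
      (Category.id_comp _) (ids_comp ((U.unit y).actR P)) (comp_idc _) rfl rfl) _ _ _ _
      (Category.id_comp _) (Category.id_comp _)).trans ?_
    exact (U.unit y).two_actR P _ (U.unit y).nil_cell
  left_right := (U.unit x).ext_left
    (((U.unit x).insert_actL _ _ _).trans ((U.unit x).insert_left _).symm)

/-- A monoid, regarded as a bimodule over itself. -/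
@[reducible]
def Mod.unitBimod (M : Mod C) : Bimod M M where
  pro := M.pro
  left := M.mon.mul
  right := M.mon.mul
  one_left := M.mon.one_mul
  mul_left := M.mon.mul_assoc
  right_one := M.mon.mul_one
  right_mul := M.mon.mul_assoc.symm
  left_right := M.mon.mul_assoc

/-- Embeddings of a monoid `M` into an object `x`: homomorphisms to the trivial monoid on `x`. -/
abbrev Emb {c : C} (M : MonoidOn c) (x : C) := MonHom (⟨c, M⟩ : Mod C) (U.trivial x)

/-- Embeddings of a bimodule `B` into a proarrow `P` over given embeddings of its monoids. -/
abbrev BimodEmb {c d : C} {M : MonoidOn c} {N : MonoidOn d} {x y : C} (i : Emb U M x)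
    (j : Emb U N y) (B : Bimod (⟨c, M⟩ : Mod C) ⟨d, N⟩) (P : Pro x y) :=
  BimodHom i j (.one B) (U.trivialBimod P)

variable {U}

/-- The cell of an embedding of a monoid `M`, as an embedding of the unit `(M, M)`-bimodule. -/
@[reducible]
noncomputable def embToBimodEmb {c : C} {M : MonoidOn c} {x : C} (i : Emb U M x) :
    BimodEmb U i i (Mod.unitBimod ⟨c, M⟩) (U.unit x).pro where
  cell := i.cell
  left := i.map_mul
  right := i.map_mul.trans
    (congrArg (fun t => comp (.two i.cell i.cell rfl) t _ _) (U.unit x).actR_self.symm)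
  inner := by
    intro W p q h
    cases h with
    | there A h => cases h

/-- A collapse of the monoid `M` is a universal embedding: every embedding of `M` factors uniquely
through it. -/
def IsCollapse {c : C} {M : MonoidOn c} {x : C} (i : Emb U M x) : Prop :=
  ∀ ⦃y : C⦄ (j : Emb U M y), ∃! k : x ⟶ y, i.comp (U.trivialHom k) = j

/-- A collapse of a bimodule `B` over collapses `i`, `j` of its monoids is a universal embedding:
composition with it induces bijections from the 2-cells `P → Q` with frames `h`, `k` to the
embeddings of `B` into `Q` over `h ∘ i` and `k ∘ j`. -/
def IsBimodCollapse {c d : C} {M : MonoidOn c} {N : MonoidOn d} {x y : C} {i : Emb U M x}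
    {j : Emb U N y} {B : Bimod (⟨c, M⟩ : Mod C) ⟨d, N⟩} {P : Pro x y}
    (φ : BimodEmb U i j B P) : Prop :=
  IsCollapse i ∧ IsCollapse j ∧
    ∀ ⦃x' y' : C⦄ (h : x ⟶ x') (k : y ⟶ y') (Q : Pro x' y')
      (ψ : BimodEmb U (i.comp (U.trivialHom h)) (j.comp (U.trivialHom k)) B Q),
      ∃! χ : Cell h k (.one P) Q, comp (.one φ.cell) χ rfl rfl = ψ.cell

/-- A normal collapse of `M` is a collapse which also exhibits the unit of its target as the
bimodule collapse of the unit `(M, M)`-bimodule. -/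
def IsNormalCollapse {c : C} {M : MonoidOn c} {x : C} (i : Emb U M x) : Prop :=
  IsCollapse i ∧ IsBimodCollapse (embToBimodEmb i)

variable (U) in
/-- The monoid `M` has a normal collapse. -/
def HasNormalCollapse {c : C} (M : MonoidOn c) : Prop :=
  ∃ (x : C) (i : Emb U M x), IsNormalCollapse i

/-- An embedding exhibits `M` as the kernel of `f` if its underlying arrow is `f` and its cell is
cartesian, i.e. exhibits `M` as the restriction of the unit along `f` on both sides; the monoid
structure on such a restriction is determined by the cell being a homomorphism. -/
def IsKernel {c d : C} (f : c ⟶ d) {M : MonoidOn c} (i : Emb U M d) : Prop :=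
  i.hom = f ∧ IsCartesian i.cell

variable (U) in
/-- A monoid is effective if it is the kernel of some vertical arrow. -/
def IsEffective {c : C} (M : MonoidOn c) : Prop :=
  ∃ (d : C) (f : c ⟶ d) (i : Emb U M d), IsKernel f i

variable (U) in
/-- A regular cover is a vertical arrow which is a normal collapse of its kernel. -/
def IsRegularCover {c d : C} (f : c ⟶ d) : Prop :=
  ∃ (M : MonoidOn c) (i : Emb U M d), IsKernel f i ∧ IsNormalCollapse i

variable (C) in
/-- A virtual equipment is regular if every effective monoid has a normal collapse and every
cartesian embedding over the kernels of two regular covers is a bimodule collapse.  (Trivial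
monoids depend on a choice of units; we ask for the conditions for every choice.) -/
structure IsRegularVirtualEquipment : Prop where
  equipment : IsVirtualEquipment C
  effective_collapse : ∀ (U : Units C) {c : C} (M : MonoidOn c), IsEffective U M →
    HasNormalCollapse U M
  cartesian_collapse : ∀ (U : Units C) {c c' d d' : C} (f : c ⟶ d) (g : c' ⟶ d'),
    IsRegularCover U f → IsRegularCover U g →
    ∀ {M : MonoidOn c} {N : MonoidOn c'} {i : Emb U M d} {j : Emb U N d'},
    IsKernel f i → IsKernel g j →
    ∀ {A : Bimod (⟨c, M⟩ : Mod C) ⟨c', N⟩} {B : Pro d d'} (φ : BimodEmb U i j A B),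
    IsCartesian φ.cell → IsBimodCollapse φ

end Equipment

end VDC

/-!
The unit of a monoid `M` in `Mod C` is `M` itself as a bimodule, with the unit of `M` as its
opcartesian cell. A nullary homomorphism out of `M` extends along it by acting with `M`; in a longer
string, `M` is absorbed into a neighbouring bimodule by its action, and compatibility with the
actions makes the choice of neighbour irrelevant.

A monoid on `X` in `Mod C` amounts to a monoid `T` in `C` on the same object together with a
homomorphism `X ⟶ T` which is the identity on objects. When the monoid is trivial this homomorphism
is invertible, so embeddings of the monoid into `Y` correspond to homomorphisms `T ⟶ Y`, and such an
embedding is a collapse exactly when `T ⟶ Y` is invertible. In particular `𝟙 T` yields a collapse of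
every monoid. Likewise embeddings of bimodules correspond to homomorphisms of the underlying
bimodules, and such an embedding over collapses is a collapse exactly when its cell is invertible.

Restrictions in `Mod C` are computed in `C`, so over frames with invertible underlying arrows the
cartesian cells are those with invertible underlying cell. Hence the kernel of `F : X ⟶ Y` has
underlying monoid isomorphic to `Y` as soon as the underlying arrow of `F` is invertible.
-/

namespace VDC

open VirtualDoubleGraph VirtualDoubleStruct VirtualDoubleCategory
open Category (id_comp comp_id)

section Composition

variable {C : Type u} [Category.{v} C] [VirtualDoubleCategory.{w, z} C]
  {a b c a' b' c' a'' b'' c'' a₃ b₃ c₃ : C} {f : a ⟶ a'} {g : b ⟶ b'} {h : c ⟶ c'}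
  {f' : a' ⟶ a''} {g' : b' ⟶ b''} {h' : c' ⟶ c''} {f'' : a'' ⟶ a₃} {g'' : b'' ⟶ b₃}
  {h'' : c'' ⟶ c₃} {u : a ⟶ a''} {v : b ⟶ b''} {w : c ⟶ c''}

theorem comp_one_comp {s : a' ⟶ a₃} {t : b' ⟶ b₃} {p : a ⟶ a₃} {q : b ⟶ b₃}
    {P : HPath (Pro (C := C)) a b} {Q : HPath (Pro (C := C)) a' b'} {A : Pro a'' b''}
    {B : Pro a₃ b₃} {x : CellPath f g P Q} {φ : Cell f' g' Q A} {ψ : Cell f'' g'' (.one A) B}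
    {hu : f ≫ f' = u} {hv : g ≫ g' = v} {hp : u ≫ f'' = p} {hq : v ≫ g'' = q}
    (hs : f' ≫ f'' = s) (ht : g' ≫ g'' = t) :
    comp (.one (comp x φ hu hv)) ψ hp hq =
      comp x (comp (.one φ) ψ hs ht) (by rw [← hs, ← hp, ← hu, Category.assoc])
        (by rw [← ht, ← hq, ← hv, Category.assoc]) :=
  (assoc ψ (vcomp_one x φ hu hv) hs ht _ _ hp hq).symm

theorem comp_comp_one {s : a' ⟶ a₃} {t : b' ⟶ b₃} {p : a ⟶ a₃} {q : b ⟶ b₃}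
    {P : HPath (Pro (C := C)) a b} {Q : HPath (Pro (C := C)) a' b'} {A : Pro a'' b''}
    {B : Pro a₃ b₃} {x : CellPath f g P Q} {φ : Cell f' g' Q A} {ψ : Cell f'' g'' (.one A) B}
    {hs : f' ≫ f'' = s} {ht : g' ≫ g'' = t} {hp : f ≫ s = p} {hq : g ≫ t = q}
    (hu : f ≫ f' = u) (hv : g ≫ g' = v) :
    comp x (comp (.one φ) ψ hs ht) hp hq =
      comp (.one (comp x φ hu hv)) ψ (by rw [← hp, ← hs, ← hu, Category.assoc])
        (by rw [← hq, ← ht, ← hv, Category.assoc]) :=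
  (comp_one_comp hs ht).symm

theorem isAppend_two {P : HPath (Pro (C := C)) a b} {Q : HPath (Pro (C := C)) b c}
    {R : HPath (Pro (C := C)) a c} {A : Pro a' b'} {B : Pro b' c'} (φ : Cell f g P A)
    (ψ : Cell g h Q B) (hR : R = P.append Q) : IsAppend (.one φ) (.one ψ) (.two φ ψ hR) :=
  isAppend_one φ (.one ψ) hR

theorem comp_comp_two {s : a' ⟶ a₃} {t : c' ⟶ c₃} {p : a ⟶ a₃} {q : c ⟶ c₃}
    {P₁ : HPath (Pro (C := C)) a b} {Q₁ : HPath (Pro (C := C)) a' b'} {B : Pro a'' b''}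
    {P₂ : HPath (Pro (C := C)) b c} {Q₂ : HPath (Pro (C := C)) b' c'} {B' : Pro b'' c''}
    {P : HPath (Pro (C := C)) a c} {Q : HPath (Pro (C := C)) a' c'} {E : Pro a₃ c₃}
    {x₁ : CellPath f g P₁ Q₁} {x₂ : CellPath g h P₂ Q₂} {x : CellPath f h P Q}
    {φ : Cell f' g' Q₁ B} {ψ : Cell g' h' Q₂ B'} {χ : Cell u v P₁ B} {ω : Cell v w P₂ B'}
    {θ : Cell f'' h'' (.cons B (.one B')) E} {hQ : Q = Q₁.append Q₂}
    {hs : f' ≫ f'' = s} {ht : h' ≫ h'' = t} {hp : f ≫ s = p} {hq : h ≫ t = q}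
    {hu : f ≫ f' = u} {hv : g ≫ g' = v} {hw : h ≫ h' = w}
    (hx : IsAppend x₁ x₂ x) (hχ : comp x₁ φ hu hv = χ) (hω : comp x₂ ψ hv hw = ω) :
    comp x (comp (.two φ ψ hQ) θ hs ht) hp hq =
      comp (.two χ ω hx.source_eq) θ (by rw [← hp, ← hs, ← hu, Category.assoc])
        (by rw [← hq, ← ht, ← hw, Category.assoc]) :=
  assoc θ (vcomp_two hx hu hv hw hχ hω hQ hx.source_eq) hs ht hp hq _ _

end Composition

section Intertwines

variable {C : Type u} [Category.{v} C] [VirtualDoubleCategory.{w, z} C]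
  {a b c a' b' c' : C} {f : a ⟶ a'} {g : b ⟶ b'} {h : c ⟶ c'}

/-- `Intertwines α x e α'`: the string of cells `x` and the cell `e` intertwine the globular cells
`α` and `α'`, that is, `α` followed by `e` is `x` followed by `α'`.  The axioms of homomorphisms
of monoids and of bimodules are equations of this form. -/
def Intertwines {R : HPath (Pro (C := C)) a b} {R' : HPath (Pro (C := C)) a' b'} {A : Pro a b}
    {A' : Pro a' b'} (α : Cell (𝟙 a) (𝟙 b) R A) (x : CellPath f g R R') (e : Cell f g (.one A) A')
    (α' : Cell (𝟙 a') (𝟙 b') R' A') : Prop :=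
  comp (.one α) e (id_comp f) (id_comp g) = comp x α' (comp_id f) (comp_id g)

variable {A : Pro a b} {A' : Pro a' b'}

theorem Intertwines.idc (e : Cell f g (.one A) A') :
    Intertwines (idc A) (.one e) e (VirtualDoubleStruct.idc A') :=
  (ids_comp e).trans (comp_idc e).symm

theorem Intertwines.two {B : Pro b c} {B' : Pro b' c'} {E : Pro a c} {E' : Pro a' c'}
    {R₁ : HPath (Pro (C := C)) a b} {R₁' : HPath (Pro (C := C)) a' b'}
    {R₂ : HPath (Pro (C := C)) b c} {R₂' : HPath (Pro (C := C)) b' c'}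
    {R : HPath (Pro (C := C)) a c} {R' : HPath (Pro (C := C)) a' c'}
    {α₁ : Cell (𝟙 a) (𝟙 b) R₁ A} {α₁' : Cell (𝟙 a') (𝟙 b') R₁' A'} {x₁ : CellPath f g R₁ R₁'}
    {α₂ : Cell (𝟙 b) (𝟙 c) R₂ B} {α₂' : Cell (𝟙 b') (𝟙 c') R₂' B'} {x₂ : CellPath g h R₂ R₂'}
    {e₁ : Cell f g (.one A) A'} {e₂ : Cell g h (.one B) B'} {e : Cell f h (.one E) E'}
    {β : Cell (𝟙 a) (𝟙 c) (.cons A (.one B)) E} {β' : Cell (𝟙 a') (𝟙 c') (.cons A' (.one B')) E'}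
    {x : CellPath f h R R'} {hR : R = R₁.append R₂} {hR' : R' = R₁'.append R₂'}
    {hAB : HPath.cons A (.one B) = (HPath.one A).append (.one B)}
    (hα₁ : Intertwines α₁ x₁ e₁ α₁') (hα₂ : Intertwines α₂ x₂ e₂ α₂')
    (hβ : Intertwines β (.two e₁ e₂ hAB) e β') (hx : IsAppend x₁ x₂ x) :
    Intertwines (comp (.two α₁ α₂ hR) β (id_comp _) (id_comp _)) x e
      (comp (.two α₁' α₂' hR') β' (id_comp _) (id_comp _)) := by
  unfold Intertwines at hβ ⊢
  rw [comp_one_comp (id_comp f) (id_comp h), hβ,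
    comp_comp_two (isAppend_two α₁ α₂ hR) hα₁ hα₂, comp_comp_two hx rfl rfl]

theorem Intertwines.inv {f' : a' ⟶ a} {g' : b' ⟶ b} {R : HPath (Pro (C := C)) a b}
    {R' : HPath (Pro (C := C)) a' b'} {α : Cell (𝟙 a) (𝟙 b) R A} {α' : Cell (𝟙 a') (𝟙 b') R' A'}
    {x : CellPath f g R R'} {y : CellPath f' g' R' R} {e : Cell f g (.one A) A'}
    {e' : Cell f' g' (.one A') A} (hαα' : Intertwines α x e α') {hf : f ≫ f' = 𝟙 a}
    {hg : g ≫ g' = 𝟙 b}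
    (hyx : VComp y x (.ids R')) (hee' : comp (.one e) e' hf hg = VirtualDoubleStruct.idc A) :
    Intertwines α' y e' α := by
  unfold Intertwines at hαα' ⊢
  have hα : comp x (comp (.one α') e' (id_comp f') (id_comp g')) hf hg = α := by
    rw [comp_comp_one (comp_id f) (comp_id g), ← hαα', comp_one_comp hf hg, hee', comp_idc]
  conv_rhs => rw [← hα]
  rw [assoc _ hyx hf hg _ _ (id_comp f') (id_comp g'), ids_comp]

end Intertwines

section Cartesian

variable {C : Type u} [Category.{v} C] [VirtualDoubleCategory.{w, z} C]
  {a b a' b' : C} {f : a ⟶ a'} {g : b ⟶ b'} {P : Pro a b} {Q : Pro a' b'}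
  {κ : Cell f g (.one P) Q}

theorem IsCartesian.existsUnique (hκ : IsCartesian κ) {c d : C} {h : c ⟶ a} {k : d ⟶ b}
    {u : c ⟶ a'} {v : d ⟶ b'} (hu : h ≫ f = u) (hv : k ≫ g = v)
    {R : HPath (Pro (C := C)) c d} (χ : Cell u v R Q) :
    ∃! ψ : Cell h k R P, comp (.one ψ) κ hu hv = χ := by
  subst hu hv
  exact hκ h k R χ

theorem IsCartesian.hom_ext (hκ : IsCartesian κ) {c d : C} {h : c ⟶ a} {k : d ⟶ b}
    {u : c ⟶ a'} {v : d ⟶ b'} {hu : h ≫ f = u} {hv : k ≫ g = v}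
    {R : HPath (Pro (C := C)) c d} {ψ ψ' : Cell h k R P}
    (e : comp (.one ψ) κ hu hv = comp (.one ψ') κ hu hv) : ψ = ψ' :=
  (hκ.existsUnique hu hv _).unique e rfl

theorem IsCartesian.exists_intertwines (hκ : IsCartesian κ) {R : HPath (Pro (C := C)) a b}
    {R' : HPath (Pro (C := C)) a' b'} (x : CellPath f g R R') (γ : Cell (𝟙 a') (𝟙 b') R' Q) :
    ∃ α : Cell (𝟙 a) (𝟙 b) R P, Intertwines α x κ γ :=
  (hκ.existsUnique (id_comp f) (id_comp g) _).exists

theorem IsCartesian.eq_of_intertwines (hκ : IsCartesian κ) {R : HPath (Pro (C := C)) a b}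
    {R' : HPath (Pro (C := C)) a' b'} {x : CellPath f g R R'} {α α' : Cell (𝟙 a) (𝟙 b) R P}
    {γ γ' : Cell (𝟙 a') (𝟙 b') R' Q} (hα : Intertwines α x κ γ) (hα' : Intertwines α' x κ γ')
    (h : γ = γ') : α = α' :=
  hκ.hom_ext (hα.trans ((congrArg (comp x · (comp_id f) (comp_id g)) h).trans hα'.symm))

theorem IsIsoCell.isCartesian (hκ : IsIsoCell κ) : IsCartesian κ := by
  obtain ⟨f', g', κ', hf, hg, hf', hg', h₁, h₂⟩ := hκ
  intro c d h k R χ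
  refine ⟨comp (.one χ) κ' (by rw [Category.assoc, hf, comp_id])
    (by rw [Category.assoc, hg, comp_id]), ?_, ?_⟩
  · dsimp only
    rw [comp_one_comp hf' hg', h₂, comp_idc]
  · rintro ψ rfl
    rw [comp_one_comp hf hg, h₁, comp_idc]

theorem IsCartesian.isIsoCell [IsIso f] [IsIso g] (hκ : IsCartesian κ) : IsIsoCell κ := by
  obtain ⟨κ', hκ', -⟩ := hκ.existsUnique (IsIso.inv_hom_id f) (IsIso.inv_hom_id g) (idc Q)
  refine ⟨inv f, inv g, κ', by simp, by simp, by simp, by simp, ?_, hκ'⟩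
  apply hκ.hom_ext (hu := id_comp f) (hv := id_comp g)
  rw [comp_one_comp (IsIso.inv_hom_id f) (IsIso.inv_hom_id g), hκ']
  exact (comp_idc κ).trans (ids_comp κ).symm

theorem IsIsoCell.isIso (hκ : IsIsoCell κ) : IsIso f ∧ IsIso g := by
  obtain ⟨f', g', -, hf, hg, hf', hg', -⟩ := hκ
  exact ⟨⟨f', hf, hf'⟩, ⟨g', hg, hg'⟩⟩

section Composite

variable {a'' b'' : C} {f' : a' ⟶ a''} {g' : b' ⟶ b''} {u : a ⟶ a''} {v : b ⟶ b''} {R : Pro a'' b''}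
  {ψ : Cell f' g' (.one Q) R} {hu : f ≫ f' = u} {hv : g ≫ g' = v}

protected theorem IsCartesian.comp (hκ : IsCartesian κ) (hψ : IsCartesian ψ) :
    IsCartesian (comp (.one κ) ψ hu hv) := by
  intro c d h k S χ
  have hu' : (h ≫ f) ≫ f' = h ≫ u := by rw [Category.assoc, hu]
  have hv' : (k ≫ g) ≫ g' = k ≫ v := by rw [Category.assoc, hv]
  obtain ⟨ω, hω, -⟩ := hψ.existsUnique hu' hv' χ
  obtain ⟨χ', hχ', -⟩ := hκ h k S ω
  refine ⟨χ', ?_, fun χ'' hχ'' ↦ hκ.hom_ext (hu := rfl) (hv := rfl) (hψ.hom_ext (hu := hu')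
    (hv := hv') ?_)⟩
  · exact (comp_comp_one rfl rfl).trans (hχ' ▸ hω)
  · rw [hχ', hω, comp_one_comp hu hv, hχ'']

theorem IsCartesian.of_comp (hψ : IsCartesian ψ) (hκψ : IsCartesian (comp (.one κ) ψ hu hv)) :
    IsCartesian κ := by
  intro c d h k S χ
  have hu' : (h ≫ f) ≫ f' = h ≫ u := by rw [Category.assoc, hu]
  have hv' : (k ≫ g) ≫ g' = k ≫ v := by rw [Category.assoc, hv]
  obtain ⟨χ', hχ', -⟩ := hκψ h k S (comp (.one χ) ψ hu' hv')
  refine ⟨χ', hψ.hom_ext (hu := hu') (hv := hv') ((comp_one_comp hu hv).trans hχ'), ?_⟩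
  rintro χ'' rfl
  exact hκψ.hom_ext (hu := rfl) (hv := rfl) ((comp_one_comp hu hv).symm.trans hχ'.symm)

protected theorem IsIsoCell.comp (hκ : IsIsoCell κ) (hψ : IsIsoCell ψ) :
    IsIsoCell (comp (.one κ) ψ hu hv) := by
  obtain ⟨_, _⟩ := hκ.isIso
  obtain ⟨_, _⟩ := hψ.isIso
  subst hu hv
  exact (hκ.isCartesian.comp hψ.isCartesian).isIsoCell

end Composite

theorem IsCartesian.exists_iso (hκ : IsCartesian κ) {P' : Pro a b} {κ' : Cell f g (.one P') Q}
    (hκ' : IsCartesian κ') : ∃ θ : Cell (𝟙 a) (𝟙 b) (.one P') P, IsIsoCell θ ∧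
      comp (.one θ) κ (id_comp f) (id_comp g) = κ' := by
  obtain ⟨θ, hθ, -⟩ := hκ.existsUnique (id_comp f) (id_comp g) κ'
  exact ⟨θ, (hκ.of_comp (hθ ▸ hκ')).isIsoCell, hθ⟩

theorem IsIsoCell.existsUnique_precomp (hκ : IsIsoCell κ) {a'' b'' : C} {h : a' ⟶ a''}
    {k : b' ⟶ b''} {u : a ⟶ a''} {v : b ⟶ b''} (hu : f ≫ h = u) (hv : g ≫ k = v) {R : Pro a'' b''}
    (ψ : Cell u v (.one P) R) : ∃! χ : Cell h k (.one Q) R, comp (.one κ) χ hu hv = ψ := by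
  obtain ⟨f', g', κ', hf, hg, hf', hg', h₁, h₂⟩ := hκ
  refine ⟨comp (.one κ') ψ (by rw [← hu, ← Category.assoc, hf', id_comp])
    (by rw [← hv, ← Category.assoc, hg', id_comp]), ?_, ?_⟩
  · refine (comp_comp_one hf hg).trans ?_
    rw [h₁]
    exact ids_comp ψ
  · rintro χ rfl
    rw [comp_comp_one hf' hg', h₂]
    exact (ids_comp χ).symm

theorem isIsoCell_of_existsUnique_precomp [IsIso f] [IsIso g]
    (hκ : ∀ ⦃a'' b'' : C⦄ (h : a' ⟶ a'') (k : b' ⟶ b'') (u : a ⟶ a'') (v : b ⟶ b'')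
      (hu : f ≫ h = u) (hv : g ≫ k = v) (R : Pro a'' b'') (ψ : Cell u v (.one P) R),
      ∃! χ : Cell h k (.one Q) R, comp (.one κ) χ hu hv = ψ) : IsIsoCell κ := by
  obtain ⟨κ', h₁, -⟩ := hκ (inv f) (inv g) _ _ (IsIso.hom_inv_id f) (IsIso.hom_inv_id g) P (idc P)
  refine ⟨inv f, inv g, κ', by simp, by simp, by simp, by simp, h₁,
    (hκ _ _ f g (comp_id f) (comp_id g) Q κ).unique ?_ (comp_idc κ)⟩
  rw [comp_comp_one (IsIso.hom_inv_id f) (IsIso.hom_inv_id g), h₁]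
  exact ids_comp κ

end Cartesian

theorem MonoidOn.exists_restrict {C : Type u} [Category.{v} C] [VirtualDoubleCategory.{w, z} C]
    {c d : C} (N : MonoidOn d) {f : c ⟶ d} {P : Pro c c} {κ : Cell f f (.one P) N.pro}
    (hκ : IsCartesian κ) :
    ∃ (M : MonoidOn c) (F : MonHom (⟨c, M⟩ : Mod C) ⟨d, N⟩), F.hom = f ∧ IsCartesian F.cell := by
  obtain ⟨e, he⟩ := hκ.exists_intertwines (.nil f) N.one
  obtain ⟨m, hm⟩ := hκ.exists_intertwines (R := .cons P (.one P)) (.two κ κ rfl) N.mul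
  refine ⟨⟨P, e, m, ?_, ?_, ?_⟩, ⟨f, κ, he, hm⟩, rfl, hκ⟩
  · exact hκ.eq_of_intertwines (he.two (.idc κ) hm (.nil f (.one κ))) (.idc κ) N.one_mul
  · exact hκ.eq_of_intertwines ((Intertwines.idc κ).two he hm (isAppend_nil _)) (.idc κ) N.mul_one
  · exact hκ.eq_of_intertwines (hm.two (.idc κ) hm (.cons _ (isAppend_two κ κ rfl) rfl rfl))
      ((Intertwines.idc κ).two hm hm (isAppend_one _ _ _)) N.mul_assoc

section Homomorphisms

variable {C : Type u} [Category.{v} C] [VirtualDoubleCategory.{w, z} C] {M N K : Mod C}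

theorem MonHom.ext_cell {f : M.obj ⟶ N.obj} {φ ψ : Cell f f (.one M.pro) N.pro} {h₁ h₂ h₃ h₄}
    (h : φ = ψ) : (⟨f, φ, h₁, h₂⟩ : MonHom M N) = ⟨f, ψ, h₃, h₄⟩ := by
  subst h
  rfl

/-- The composite of two homomorphisms of monoids, with a prescribed form of the composite of the
underlying vertical arrows. -/
def MonHom.compOfEq (F : MonHom M N) (G : MonHom N K) {f : M.obj ⟶ K.obj} (h : F.hom ≫ G.hom = f) :
    MonHom M K where
  hom := f
  cell := VirtualDoubleStruct.comp (.one F.cell) G.cell h h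
  map_one := by
    subst h
    exact (F.comp G).map_one
  map_mul := by
    subst h
    exact (F.comp G).map_mul

theorem MonHom.compOfEq_eq (F : M ⟶ N) (G : N ⟶ K) {f : M.obj ⟶ K.obj}
    (h : MonHom.hom F ≫ MonHom.hom G = f) : MonHom.compOfEq F G h = F ≫ G := by
  subst h
  rfl

theorem MonHom.comp_cell_eq {N' : Mod C} {F : M ⟶ N} {G : N ⟶ K} {F' : M ⟶ N'} {G' : N' ⟶ K}
    (h : F ≫ G = F' ≫ G') {f : M.obj ⟶ K.obj} (hf : MonHom.hom F ≫ MonHom.hom G = f)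
    (hf' : MonHom.hom F' ≫ MonHom.hom G' = f) :
    VirtualDoubleStruct.comp (.one (MonHom.cell F)) (MonHom.cell G) hf hf =
      VirtualDoubleStruct.comp (.one (MonHom.cell F')) (MonHom.cell G') hf' hf' := by
  subst hf'
  exact cell_comp_eq h

instance MonHom.isIso_hom (F : M ⟶ N) [IsIso F] : IsIso (MonHom.hom F) :=
  ⟨MonHom.hom (inv F), hom_comp_eq (IsIso.hom_inv_id F), hom_comp_eq (IsIso.inv_hom_id F)⟩

theorem MonHom.isIsoCell_cell (F : M ⟶ N) [IsIso F] : IsIsoCell (MonHom.cell F) :=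
  ⟨_, _, MonHom.cell (inv F), hom_comp_eq (IsIso.hom_inv_id F), hom_comp_eq (IsIso.hom_inv_id F),
    hom_comp_eq (IsIso.inv_hom_id F), hom_comp_eq (IsIso.inv_hom_id F),
    cell_comp_eq (IsIso.hom_inv_id F), cell_comp_eq (IsIso.inv_hom_id F)⟩

theorem MonHom.comp_eq_id {F : M ⟶ N} {G : N ⟶ M}
    (h : MonHom.hom F ≫ MonHom.hom G = 𝟙 M.obj)
    (hc : VirtualDoubleStruct.comp (.one (MonHom.cell F)) (MonHom.cell G) h h = idc M.pro) :
    F ≫ G = 𝟙 M := by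
  rw [← MonHom.compOfEq_eq F G h]
  exact MonHom.ext_cell hc

theorem MonHom.isIso_of_isIsoCell (F : M ⟶ N) (h : IsIsoCell (MonHom.cell F)) : IsIso F := by
  obtain ⟨f', g', ψ, hf, hg, hf', hg', h₁, h₂⟩ := h
  obtain rfl : f' = g' := by rw [← id_comp g', ← hf', Category.assoc, hg, comp_id]
  let G : N ⟶ M :=
    { hom := f'
      cell := ψ
      map_one := Intertwines.inv (MonHom.map_one F) (.nil hf') h₁
      map_mul := Intertwines.inv (MonHom.map_mul F)
        (vcomp_two (isAppend_two ψ ψ rfl) hf' hf' hf' h₂ h₂ rfl rfl) h₁ }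
  exact ⟨G, MonHom.comp_eq_id hf h₁, MonHom.comp_eq_id hf' h₂⟩

end Homomorphisms

section Actions

variable {C : Type u} [Category.{v} C] [VirtualDoubleCategory.{w, z} C] {M N : Mod C}
  (B : Bimod M N) {a b : C} {f : a ⟶ M.obj} {g : b ⟶ N.obj} {R : HPath (Pro (C := C)) a b}

theorem Bimod.two_one_left (φ : Cell f g R B.pro) :
    comp (.two (comp (.nil f) M.mon.one (comp_id f) (comp_id f)) φ rfl) B.left (comp_id f)
      (comp_id g) = φ := by
  have h := comp_comp_two (φ := M.mon.one) (θ := B.left) (hs := id_comp _) (ht := id_comp _)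
    (hp := comp_id f) (hq := comp_id g) (hu := comp_id f) (hv := comp_id f) (hQ := rfl)
    (.nil f (.one φ)) rfl (comp_idc φ)
  exact h.symm.trans ((congrArg (comp (.one φ) · (comp_id f) (comp_id g)) B.one_left).trans
    (comp_idc φ))

theorem Bimod.two_one_right (φ : Cell f g R B.pro) :
    comp (.two φ (comp (.nil g) N.mon.one (comp_id g) (comp_id g)) R.append_nil.symm) B.right
      (comp_id f) (comp_id g) = φ := by
  have h := comp_comp_two (ψ := N.mon.one) (θ := B.right) (hs := id_comp _) (ht := id_comp _)
    (hp := comp_id f) (hq := comp_id g) (hv := comp_id g) (hw := comp_id g) (hQ := rfl)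
    (isAppend_nil (.one φ)) (comp_idc φ) rfl
  exact h.symm.trans ((congrArg (comp (.one φ) · (comp_id f) (comp_id g)) B.right_one).trans
    (comp_idc φ))

end Actions

section Units

variable {C : Type u} [Category.{v} C] [VirtualDoubleCategory.{w, z} C] {x : C} (η : UnitOf x)

theorem UnitOf.hom_ext {y z : C} {f : x ⟶ y} {g : x ⟶ z} {T : Pro y z}
    {ψ ψ' : Cell f g (.one η.pro) T}
    (h : comp (.one η.cell) ψ (id_comp f) (id_comp g) =
      comp (.one η.cell) ψ' (id_comp f) (id_comp g)) : ψ = ψ' :=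
  η.ext_left (S := .nil x) h

/-- The extension of a nullary cell along the unit cell. -/
noncomputable def UnitOf.extend {y z : C} {f : x ⟶ y} {g : x ⟶ z} {T : Pro y z}
    (χ : Cell f g (.nil x) T) : Cell f g (.one η.pro) T :=
  (η.opcartesian (.nil x) (.nil x) f g T χ).choose

theorem UnitOf.unit_extend {y z : C} {f : x ⟶ y} {g : x ⟶ z} {T : Pro y z}
    (χ : Cell f g (.nil x) T) :
    comp (.one η.cell) (η.extend χ) (id_comp f) (id_comp g) = χ :=
  (η.opcartesian (.nil x) (.nil x) f g T χ).choose_spec.1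

/-- The trivial monoid on `x` is free on `x`: a vertical arrow from `x` to the object underlying a
monoid lifts to a homomorphism of monoids, which is unique by `UnitOf.monHom_ext`. -/
noncomputable def UnitOf.lift (N : Mod C) (f : x ⟶ N.obj) :
    MonHom (⟨x, η.trivialOn⟩ : Mod C) N where
  hom := f
  cell := η.extend (comp (.nil f) N.mon.one (comp_id f) (comp_id f))
  map_one := η.unit_extend _
  map_mul := by
    have hφ := η.unit_extend (comp (.nil f) N.mon.one (comp_id f) (comp_id f))
    generalize η.extend _ = φ at hφ ⊢
    apply η.ext_left
    refine .trans (b := φ) ?_ ?_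
    · refine (comp_comp_one (id_comp _) (id_comp _)).trans ?_
      exact (congrArg (fun t ↦ comp (.one t) φ _ _) (η.unit_actL η.pro)).trans (ids_comp φ)
    · exact ((comp_comp_two (isAppend_one η.cell (.ids (.one η.pro)) rfl) hφ
        (ids_comp φ)).trans (N.unitBimod.two_one_left φ)).symm

variable {η}

theorem UnitOf.monHom_ext {N : Mod C} {F G : MonHom (⟨x, η.trivialOn⟩ : Mod C) N}
    (h : F.hom = G.hom) : F = G := by
  obtain ⟨f, φ, hφ, _⟩ := F
  obtain ⟨g, ψ, hψ, _⟩ := G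
  obtain rfl : f = g := h
  exact MonHom.ext_cell (η.hom_ext (hφ.trans hψ.symm))

variable (η)

instance UnitOf.isIso_lift (θ : UnitOf x) :
    IsIso (X := (⟨x, η.trivialOn⟩ : Mod C)) (η.lift ⟨x, θ.trivialOn⟩ (𝟙 x)) :=
  ⟨θ.lift ⟨x, η.trivialOn⟩ (𝟙 x), UnitOf.monHom_ext (id_comp _), UnitOf.monHom_ext (id_comp _)⟩

theorem UnitOf.two_lift_left {M N : Mod C} (θ : UnitOf M.obj) (B : Bimod M N) :
    comp (.two (θ.lift M (𝟙 _)).cell (idc B.pro) rfl) B.left (id_comp _) (id_comp _) =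
      θ.actL B.pro := by
  apply θ.ext_left
  exact (comp_comp_two (isAppend_one θ.cell (.ids (.one B.pro)) rfl) (θ.lift M (𝟙 _)).map_one
    (ids_comp _)).trans ((B.two_one_left _).trans (θ.unit_actL B.pro).symm)

theorem UnitOf.two_lift_right {M N : Mod C} (θ : UnitOf N.obj) (B : Bimod M N) :
    comp (.two (idc B.pro) (θ.lift N (𝟙 _)).cell rfl) B.right (id_comp _) (id_comp _) =
      θ.actR B.pro := by
  apply θ.ext_right (R := .one B.pro)
  exact (comp_comp_two (isAppend_one _ _ _) (ids_comp _) (θ.lift N (𝟙 _)).map_one).trans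
    ((B.two_one_right _).trans (θ.unit_actR B.pro).symm)

end Units

section UnitsOfMod

variable {C : Type u} [Category.{v} C] [VirtualDoubleCategory.{w, z} C] {M N : Mod C}

theorem innerCompat_one {A : Bimod M N} {a b : C} {f : M.obj ⟶ a} {g : N.obj ⟶ b} {B : Pro a b}
    (φ : Cell f g (under (.one A)) B) : InnerCompat (.one A) φ := by
  rintro W x y (_ | ⟨_, ⟨⟩⟩)

theorem innerCompat_two {L : Mod C} {A : Bimod M L} {A' : Bimod L N} {a b : C}
    {f : M.obj ⟶ a} {g : N.obj ⟶ b} {B : Pro a b} {φ : Cell f g (under (.cons A (.one A'))) B}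
    (hφ : comp (P := .cons A.pro (.cons L.pro (.one A'.pro))) (.two A.right (idc A'.pro) rfl) φ
        (id_comp f) (id_comp g) =
      comp (P := .cons A.pro (.cons L.pro (.one A'.pro))) (.two (idc A.pro) A'.left rfl) φ
        (id_comp f) (id_comp g)) :
    InnerCompat (.cons A (.one A')) φ := by
  rintro W x y (_ | ⟨_, _ | ⟨_, ⟨⟩⟩⟩)
  exact hφ

/-- The left action of a bimodule, as a bimodule homomorphism. -/
def Bimod.leftHom (A : Bimod M N) : BimodHom (𝟙 M) (𝟙 N) (.cons M.unitBimod (.one A)) A where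
  cell := A.left
  left := A.mul_left
  right := A.left_right.symm
  inner := innerCompat_two A.mul_left

/-- The right action of a bimodule, as a bimodule homomorphism. -/
def Bimod.rightHom (A : Bimod M N) : BimodHom (𝟙 M) (𝟙 N) (.cons A (.one N.unitBimod)) A where
  cell := A.right
  left := A.left_right
  right := A.right_mul
  inner := innerCompat_two A.right_mul.symm

/-- The unit of a monoid, as a bimodule homomorphism. -/
def Mod.oneHom (M : Mod C) : BimodHom (𝟙 M) (𝟙 M) (.nil M) M.unitBimod where
  cell := M.mon.one
  left := M.mon.mul_one.trans M.mon.one_mul.symm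
  right := trivial
  inner := by rintro W x y ⟨⟩

theorem Bimod.one_leftHom (A : Bimod M N) :
    comp (C := Mod C) (P := .one A) (.two (C := Mod C) M.oneHom (BimodHom.id A) rfl) A.leftHom
      (id_comp _) (id_comp _) = BimodHom.id A :=
  BimodHom.ext A.one_left

theorem Bimod.rightHom_one (A : Bimod M N) :
    comp (C := Mod C) (P := .one A) (.two (C := Mod C) (BimodHom.id A) N.oneHom rfl) A.rightHom
      (id_comp _) (id_comp _) = BimodHom.id A :=
  BimodHom.ext A.right_one

section Insertion

variable {K L : Mod C}

/-- Inserting the unit of a monoid into a string of bimodules. -/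
abbrev insertUnit (R : HPath (Bimod (C := C)) M L) (S : HPath (Bimod (C := C)) L N) :
    CellPath (C := Mod C) (𝟙 M) (𝟙 N) (R.append S) (R.append (.cons L.unitBimod S)) :=
  (CellPath.ids (C := Mod C) R).append (.cons (C := Mod C) L.oneHom (.ids (C := Mod C) S) rfl)

/-- Absorbing a monoid, placed after a nonempty string of bimodules, into the last one of them. -/
def absorb {L : Mod C} : {M K N : Mod C} → (A : Bimod M K) → (R : HPath (Bimod (C := C)) K L) →
    (S : HPath (Bimod (C := C)) L N) → CellPath (C := Mod C) (𝟙 M) (𝟙 N)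
      ((HPath.cons A R).append (.cons L.unitBimod S)) ((HPath.cons A R).append S)
  | _, _, _, A, .nil _, S => .cons (C := Mod C) A.rightHom (.ids (C := Mod C) S) rfl
  | _, _, _, A, .cons A' R, S => .cons (C := Mod C) (BimodHom.id A) (absorb A' R S) rfl

theorem vcomp_insertUnit_absorb (A : Bimod M K) (R : HPath (Bimod (C := C)) K L)
    (S : HPath (Bimod (C := C)) L N) :
    VComp (insertUnit (.cons A R) S) (absorb A R S)
      (CellPath.ids (C := Mod C) ((HPath.cons A R).append S)) := by
  induction R generalizing M with
  | nil L =>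
    refine .cons' (x₁ := .two (idc (C := Mod C) A) L.oneHom rfl)
      (.cons _ (isAppend_one _ _ _) _ _) (id_comp _) (id_comp _) A.rightHom_one (ids_vcomp _) _ _
  | cons A' R ih =>
    exact .cons' (isAppend_one _ _ _) (id_comp _) (id_comp _)
      (comp_idc (C := Mod C) (idc (C := Mod C) A)) (ih A' S) _ _

theorem vcomp_insertUnit_leftHom (A : Bimod M K) (S : HPath (Bimod (C := C)) K N) :
    VComp (insertUnit (.nil M) (.cons A S))
      (.cons (C := Mod C) A.leftHom (.ids (C := Mod C) S) rfl)
      (CellPath.ids (C := Mod C) (.cons A S)) := by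
  refine .cons' (x₁ := .two M.oneHom (idc (C := Mod C) A) rfl) (.cons _ (isAppend_one _ _ _) _ _)
    (id_comp _) (id_comp _) A.one_leftHom (ids_vcomp _) _ _

theorem exists_move_absorb (A : Bimod M K) (R : HPath (Bimod (C := C)) K L)
    (S : HPath (Bimod (C := C)) L N) :
    ∃ x, VComp (absorb A R S) (insertUnit (.cons A R) S) x ∧
      Move ((HPath.cons A R).append (.cons L.unitBimod S)) (underCells x)
        (underCells (CellPath.ids (C := Mod C) _)) := by
  induction R generalizing M with
  | nil L =>
    refine ⟨.cons (C := Mod C) A.rightHom (.cons (C := Mod C) L.oneHom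
      (.ids (C := Mod C) S) rfl) rfl, ?_, ?_⟩
    · refine .cons' (isAppend_one _ _ _) (comp_id _) (comp_id _)
        (comp_idc (C := Mod C) A.rightHom) ?_ _ _
      exact .cons' (.nil _ _) (comp_id _) (comp_id _) (ids_comp (C := Mod C) L.oneHom)
        (vcomp_ids _) _ _
    · have h := Move.here A L.unitBimod S (idc A.pro) (idc L.pro) L.mon.one
        (CellPath.ids (under S)) (RS := .cons A.pro (.one L.pro)) rfl rfl (ST := .one L.pro) rfl
        rfl rfl rfl
      rw [show comp (.two (idc A.pro) (idc L.pro) _) A.right _ _ = A.right from ids_comp A.right,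
        show comp (P := .one L.pro) (.two (idc L.pro) L.mon.one _) L.mon.mul _ _ = idc L.pro from
          L.mon.mul_one, ← underCells_ids S] at h
      exact h
  | cons A' R ih =>
    obtain ⟨x, hx, hm⟩ := ih A' S
    refine ⟨.cons (C := Mod C) (BimodHom.id A) x rfl, ?_, .there A _ hm _⟩
    exact .cons' (isAppend_one _ _ _) (comp_id _) (comp_id _)
      (comp_idc (C := Mod C) (idc (C := Mod C) A)) hx _ _

theorem exists_move_leftHom (A : Bimod M K) (S : HPath (Bimod (C := C)) K N) :
    ∃ x, VComp (.cons (C := Mod C) A.leftHom (.ids (C := Mod C) S) rfl)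
        (insertUnit (.nil M) (.cons A S)) x ∧
      Move (.cons M.unitBimod (.cons A S)) (underCells (CellPath.ids (C := Mod C) _))
        (underCells x) := by
  refine ⟨.cons (C := Mod C) M.oneHom (.cons (C := Mod C) A.leftHom
    (.ids (C := Mod C) S) rfl) rfl, ?_, ?_⟩
  · exact .cons' (.nil _ _) (comp_id _) (comp_id _) (ids_comp (C := Mod C) M.oneHom)
      (vcomp_ids _) _ _
  · have h := Move.here M.unitBimod A S M.mon.one (idc M.pro) (idc A.pro)
      (CellPath.ids (under S)) (RS := .one M.pro) rfl rfl (ST := .cons M.pro (.one A.pro)) rfl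
      rfl rfl rfl
    rw [show comp (.two (idc M.pro) (idc A.pro) _) A.left _ _ = A.left from ids_comp A.left,
      show comp (P := .one M.pro) (.two M.mon.one (idc M.pro) _) M.mon.mul _ _ = idc M.pro from
        M.mon.one_mul, ← underCells_ids S] at h
    exact h

theorem existsUnique_comp_of_moves {M' N' : Mod C} {P Q : HPath (Bimod (C := C)) M N}
    {s : CellPath (C := Mod C) (𝟙 M) (𝟙 N) P Q} {r : CellPath (C := Mod C) (𝟙 M) (𝟙 N) Q P}
    {e : CellPath (C := Mod C) (𝟙 M) (𝟙 N) Q Q} (hsr : VComp s r (.ids (C := Mod C) P))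
    (hrs : VComp r s e) (he : Moves Q (underCells e) (underCells (.ids (C := Mod C) Q)))
    {F : M ⟶ M'} {G : N ⟶ N'} {T : Bimod M' N'} (χ : Cell (C := Mod C) F G P T) :
    ∃! ψ : Cell (C := Mod C) F G Q T, comp s ψ (id_comp F) (id_comp G) = χ := by
  refine ⟨comp r χ (id_comp F) (id_comp G), ?_, ?_⟩
  · exact (assoc χ hsr _ _ _ _ (id_comp F) (id_comp G)).trans (ids_comp χ)
  · rintro ψ rfl
    refine (ids_comp ψ).symm.trans (.trans ?_ (assoc ψ hrs _ _ _ _ (id_comp F) (id_comp G)).symm)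
    exact BimodHom.ext (he.comp_eq (BimodHom.inner ψ) _ _).symm

end Insertion

section Extension

variable {X Y : Mod C} {T : Bimod X Y}

theorem MonHom.mul_comp_two_left (F : MonHom M X) {b : C} {g : b ⟶ Y.obj}
    {R : HPath (Pro (C := C)) M.obj b} (χ : Cell F.hom g R T.pro) :
    VirtualDoubleStruct.comp (P := .cons M.pro (.cons M.pro R)) (.cons M.mon.mul (.ids R) rfl)
        (VirtualDoubleStruct.comp (P := .cons M.pro R) (.two F.cell χ rfl) T.left (comp_id _)
          (comp_id _)) (id_comp _) (id_comp _) =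
      VirtualDoubleStruct.comp (P := .cons M.pro (.cons M.pro R)) (.two F.cell
        (VirtualDoubleStruct.comp (P := .cons M.pro R) (.two F.cell χ rfl) T.left (comp_id _)
          (comp_id _)) rfl) T.left (comp_id _) (comp_id _) := by
  refine (comp_comp_two (isAppend_one _ _ _) F.map_mul (ids_comp χ)).trans ?_
  refine (comp_comp_two (x := .cons F.cell (.two F.cell χ rfl) rfl) (hs := id_comp _)
    (ht := id_comp _) (hp := comp_id _) (hq := comp_id _) (hQ := rfl)
    (.cons _ (isAppend_one _ _ _) _ _) rfl (comp_idc χ)).symm.trans ?_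
  rw [T.mul_left]
  exact comp_comp_two (isAppend_one _ _ _) (comp_idc _) rfl

variable {F : M ⟶ X} {G : M ⟶ Y}

/-- The extension of a nullary homomorphism along the unit of its monoid. -/
def BimodHom.extend (χ : BimodHom F G (.nil M) T) : BimodHom F G (.one M.unitBimod) T where
  cell := VirtualDoubleStruct.comp (P := .one M.pro) (.two (MonHom.cell F) χ.cell rfl) T.left
    (comp_id _) (comp_id _)
  left := MonHom.mul_comp_two_left F χ.cell
  right := by
    refine (MonHom.mul_comp_two_left F χ.cell).trans ?_
    refine .trans ?_ (comp_comp_two (x := .cons (MonHom.cell F) (.two χ.cell (MonHom.cell G) rfl)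
      rfl) (hs := id_comp _) (ht := id_comp _) (hp := comp_id _) (hq := comp_id _) (hQ := rfl)
      (.cons _ (isAppend_one _ _ _) _ _) rfl (comp_idc (MonHom.cell G)))
    rw [T.left_right]
    exact (comp_comp_two (isAppend_one _ _ _) (comp_idc _) χ.left.symm).symm
  inner := innerCompat_one _

theorem BimodHom.one_extend (χ : BimodHom F G (.nil M) T) :
    VirtualDoubleStruct.comp (C := Mod C) (.one (C := Mod C) M.oneHom) χ.extend
      (id_comp F) (id_comp G) = χ :=
  BimodHom.ext ((comp_comp_two (isAppend_one M.mon.one (.nil (𝟙 M.obj)) rfl) (MonHom.map_one F)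
    (ids_comp χ.cell)).trans (T.two_one_left χ.cell))

theorem BimodHom.extend_one (ψ : BimodHom F G (.one M.unitBimod) T) :
    BimodHom.extend (VirtualDoubleStruct.comp (C := Mod C) (.one (C := Mod C) M.oneHom) ψ
      (id_comp F) (id_comp G)) = ψ := by
  refine BimodHom.ext ?_
  refine (comp_comp_two (x := .two (idc M.pro) M.mon.one rfl) (hs := comp_id _) (ht := comp_id _)
    (hp := id_comp _) (hq := id_comp _) (hQ := rfl) (isAppend_one _ _ _)
    (ids_comp (MonHom.cell F)) rfl).symm.trans ?_
  refine (congrArg (fun t ↦ VirtualDoubleStruct.comp _ t _ _) ψ.left.symm).trans ?_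
  refine (comp_comp_one (id_comp _) (id_comp _)).trans ?_
  exact (congrArg (fun t ↦ VirtualDoubleStruct.comp (.one t) _ _ _) M.mon.mul_one).trans
    (ids_comp ψ.cell)

end Extension

theorem Mod.isOpcartesian_oneHom (M : Mod C) : IsOpcartesian (C := Mod C) M.oneHom := by
  intro K N X Y R S F G T χ
  cases R with
  | cons A R =>
    obtain ⟨e, he, hm⟩ := exists_move_absorb A R S
    exact existsUnique_comp_of_moves (vcomp_insertUnit_absorb A R S) he (.rel _ _ hm) χ
  | nil =>
    cases S with
    | cons A S =>
      obtain ⟨e, he, hm⟩ := exists_move_leftHom A S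
      exact existsUnique_comp_of_moves (vcomp_insertUnit_leftHom A S) he (.symm _ _ (.rel _ _ hm)) χ
    | nil =>
      refine ⟨BimodHom.extend χ, BimodHom.one_extend χ, ?_⟩
      rintro ψ rfl
      exact (BimodHom.extend_one ψ).symm

/-- The unit of a monoid in `Mod C` is the monoid itself. -/
def Mod.unitOf (M : Mod C) : UnitOf M where
  pro := M.unitBimod
  cell := M.oneHom
  opcartesian := M.isOpcartesian_oneHom

theorem Mod.unitOf_actL (A : Bimod M N) : M.unitOf.actL A = A.leftHom :=
  M.unitOf.ext_left ((M.unitOf.unit_actL A).trans A.one_leftHom.symm)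

theorem Mod.unitOf_actR (A : Bimod M N) : N.unitOf.actR A = A.rightHom :=
  N.unitOf.ext_right (R := .one A) ((N.unitOf.unit_actR A).trans A.rightHom_one.symm)

end UnitsOfMod

section RestrictionsOfMod

variable {C : Type u} [Category.{v} C] [VirtualDoubleCategory.{w, z} C] {M M' N N' : Mod C}

theorem Bimod.exists_restrict (F : MonHom M N) (G : MonHom M' N')
    (B : Bimod N N') {P : Pro M.obj M'.obj} {κ : Cell F.hom G.hom (.one P) B.pro}
    (hκ : IsCartesian κ) : ∃ (A : Bimod M M') (φ : BimodHom F G (.one A) B),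
      IsCartesian (P := A.pro) φ.cell := by
  obtain ⟨l, hl⟩ :=
    hκ.exists_intertwines (R := .cons M.pro (.one P)) (.two F.cell κ rfl) B.left
  obtain ⟨r, hr⟩ :=
    hκ.exists_intertwines (R := .cons P (.one M'.pro)) (.two κ G.cell rfl) B.right
  let A : Bimod M M' :=
    { pro := P
      left := l
      right := r
      one_left := hκ.eq_of_intertwines
        (Intertwines.two F.map_one (.idc κ) hl (.nil F.hom (.one κ))) (.idc κ) B.one_left
      mul_left := hκ.eq_of_intertwines
        (Intertwines.two F.map_mul (.idc κ) hl (.cons _ (isAppend_two F.cell κ rfl) rfl rfl))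
        ((Intertwines.idc F.cell).two hl hl (isAppend_one _ _ _)) B.mul_left
      right_one := hκ.eq_of_intertwines
        ((Intertwines.idc κ).two G.map_one hr (isAppend_nil _)) (.idc κ) B.right_one
      right_mul := hκ.eq_of_intertwines
        ((Intertwines.idc κ).two G.map_mul hr (isAppend_one _ _ _))
        (hr.two (.idc G.cell) hr (.cons _ (isAppend_two G.cell G.cell rfl) rfl rfl)) B.right_mul
      left_right := hκ.eq_of_intertwines
        (hl.two (.idc G.cell) hr (.cons _ (isAppend_two κ G.cell rfl) rfl rfl))
        ((Intertwines.idc F.cell).two hr hl (isAppend_one _ _ _)) B.left_right }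
  exact ⟨A, ⟨κ, hl, hr, innerCompat_one (A := A) κ⟩, hκ⟩

section Factorization

variable {F : MonHom M N} {G : MonHom M' N'} {A : Bimod M M'} {B : Bimod N N'}
  {φ : BimodHom F G (.one A) B} {K K' : Mod C} {H : MonHom K M} {H' : MonHom K' M'}

theorem BimodHom.comp_two_left {R : HPath (Pro (C := C)) K.obj K'.obj}
    {ψ : Cell H.hom H'.hom R A.pro} {χ : Cell (H.comp F).hom (H'.comp G).hom R B.pro}
    (hψ : VirtualDoubleStruct.comp (.one ψ) φ.cell rfl rfl = χ) :
    VirtualDoubleStruct.comp (.one (VirtualDoubleStruct.comp (P := .cons K.pro R)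
        (.two H.cell ψ rfl) A.left (comp_id _) (comp_id _))) φ.cell rfl rfl =
      VirtualDoubleStruct.comp (P := .cons K.pro R) (.two (H.comp F).cell χ rfl) B.left
        (comp_id _) (comp_id _) :=
  (comp_one_comp (id_comp _) (id_comp _)).trans
    ((congrArg (VirtualDoubleStruct.comp _ · rfl rfl) φ.left).trans
      (comp_comp_two (isAppend_one _ _ _) rfl hψ))

theorem BimodHom.comp_two_right {R W : HPath (Pro (C := C)) K.obj K'.obj}
    {ψ : Cell H.hom H'.hom R A.pro} {χ : Cell (H.comp F).hom (H'.comp G).hom R B.pro}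
    (hψ : VirtualDoubleStruct.comp (.one ψ) φ.cell rfl rfl = χ)
    (hW : W = R.append (HPath.one K'.pro)) :
    VirtualDoubleStruct.comp (.one (VirtualDoubleStruct.comp (.two ψ H'.cell hW) A.right
        (comp_id _) (comp_id _))) φ.cell rfl rfl =
      VirtualDoubleStruct.comp (.two χ (H'.comp G).cell hW) B.right (comp_id _) (comp_id _) :=
  (comp_one_comp (id_comp _) (id_comp _)).trans
    ((congrArg (VirtualDoubleStruct.comp _ · rfl rfl) φ.right).trans
      (comp_comp_two (isAppend_one _ _ _) hψ rfl))

variable {R : HPath (Bimod (C := C)) K K'} {ψ : Cell H.hom H'.hom (under R) A.pro}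
  {χ : BimodHom (H.comp F) (H'.comp G) R B}

theorem BimodHom.comp_comp_cell (hψ : VirtualDoubleStruct.comp (.one ψ) φ.cell rfl rfl = χ.cell)
    {W : HPath (Pro (C := C)) K.obj K'.obj} (x : CellPath (𝟙 _) (𝟙 _) W (under R)) :
    VirtualDoubleStruct.comp (.one (VirtualDoubleStruct.comp x ψ (id_comp _) (id_comp _)))
        φ.cell rfl rfl =
      VirtualDoubleStruct.comp x χ.cell (id_comp _) (id_comp _) := by
  rw [← hψ]
  exact comp_one_comp rfl rfl

theorem BimodHom.leftCompat_of_comp (hφ : IsCartesian (P := A.pro) φ.cell)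
    (hψ : VirtualDoubleStruct.comp (.one ψ) φ.cell rfl rfl = χ.cell) :
    LeftCompat A R H H' ψ := by
  cases R with
  | nil =>
    exact hφ.hom_ext ((BimodHom.comp_two_left hψ).trans
      (χ.left.trans (BimodHom.comp_two_right hψ rfl).symm))
  | cons =>
    exact hφ.hom_ext ((BimodHom.comp_comp_cell hψ _).trans
      (χ.left.trans (BimodHom.comp_two_left hψ).symm))

theorem BimodHom.rightCompat_of_comp (hφ : IsCartesian (P := A.pro) φ.cell)
    (hψ : VirtualDoubleStruct.comp (.one ψ) φ.cell rfl rfl = χ.cell) :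
    RightCompat A R H H' ψ := by
  cases R with
  | nil => trivial
  | cons =>
    exact hφ.hom_ext ((BimodHom.comp_comp_cell hψ _).trans
      (χ.right.trans (BimodHom.comp_two_right hψ _).symm))

theorem BimodHom.innerCompat_of_comp (hφ : IsCartesian (P := A.pro) φ.cell)
    (hψ : VirtualDoubleStruct.comp (.one ψ) φ.cell rfl rfl = χ.cell) :
    InnerCompat R ψ := fun W x y hxy ↦
  hφ.hom_ext ((BimodHom.comp_comp_cell hψ x).trans
    ((χ.inner W x y hxy).trans (BimodHom.comp_comp_cell hψ y).symm))

end Factorization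

section Cartesian

variable {F : M ⟶ N} {G : M' ⟶ N'} {A : Bimod M M'} {B : Bimod N N'}
  {φ : BimodHom F G (.one A) B}

theorem BimodHom.isCartesian_of_cell (hφ : IsCartesian (P := A.pro) φ.cell) :
    IsCartesian (C := Mod C) φ := by
  intro K K' H H' R χ
  obtain ⟨ψ, hψ, huniq⟩ := hφ.existsUnique rfl rfl (BimodHom.cell χ)
  exact ⟨⟨ψ, BimodHom.leftCompat_of_comp hφ hψ, BimodHom.rightCompat_of_comp hφ hψ,
    BimodHom.innerCompat_of_comp hφ hψ⟩, BimodHom.ext hψ, fun ψ' h ↦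
    BimodHom.ext (huniq _ (congrArg BimodHom.cell h))⟩

theorem IsIsoCell.under (hφ : IsIsoCell (C := Mod C) φ) : IsIsoCell (P := A.pro) φ.cell := by
  obtain ⟨F', G', ψ, hF, hG, hF', hG', h₁, h₂⟩ := hφ
  exact ⟨_, _, BimodHom.cell ψ, hom_comp_eq hF, hom_comp_eq hG, hom_comp_eq hF',
    hom_comp_eq hG', congrArg BimodHom.cell h₁, congrArg BimodHom.cell h₂⟩

/-- The existence of all restrictions of proarrows along vertical arrows. -/
def HasRestrictions (C : Type u) [Category.{v} C] [VirtualDoubleCategory.{w, z} C] : Prop :=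
  ∀ {a b a' b' : C} (f : a ⟶ a') (g : b ⟶ b') (Q : Pro a' b'),
    ∃ (P : Pro a b) (κ : Cell f g (.one P) Q), IsCartesian κ

theorem isVirtualEquipment_mod (hC : HasRestrictions C) : IsVirtualEquipment (Mod C) where
  has_units M := ⟨M.unitOf⟩
  has_restrictions F G B := by
    obtain ⟨P, κ, hκ⟩ := hC (MonHom.hom F) (MonHom.hom G) (Bimod.pro B)
    obtain ⟨A, φ, hφ⟩ := Bimod.exists_restrict F G B hκ
    exact ⟨A, φ, BimodHom.isCartesian_of_cell hφ⟩

theorem BimodHom.isCartesian_iff_isIsoCell (hC : HasRestrictions C) [IsIso (MonHom.hom F)]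
    [IsIso (MonHom.hom G)] :
    IsCartesian (C := Mod C) φ ↔ IsIsoCell (P := A.pro) φ.cell := by
  refine ⟨fun hφ ↦ ?_, fun hφ ↦ BimodHom.isCartesian_of_cell hφ.isCartesian⟩
  obtain ⟨P, κ, hκ⟩ := hC (MonHom.hom F) (MonHom.hom G) B.pro
  obtain ⟨A', κ', hκ'⟩ := Bimod.exists_restrict F G B hκ
  obtain ⟨θ, hθ, rfl⟩ := (BimodHom.isCartesian_of_cell hκ').exists_iso hφ
  exact hθ.under.comp hκ'.isIsoCell

end Cartesian

end RestrictionsOfMod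

section Total

variable {C : Type u} [Category.{v} C] [VirtualDoubleCategory.{w, z} C] {M N K : Mod (Mod C)}

/-- The monoid in `C` underlying a monoid in `Mod C`. -/
@[reducible]
def Mod.total (M : Mod (Mod C)) : Mod C where
  obj := M.obj.obj
  mon :=
    { pro := Bimod.pro M.pro
      one := BimodHom.cell M.mon.one
      mul := BimodHom.cell M.mon.mul
      one_mul := congrArg BimodHom.cell M.mon.one_mul
      mul_one := congrArg BimodHom.cell M.mon.mul_one
      mul_assoc := congrArg BimodHom.cell M.mon.mul_assoc }

/-- The homomorphism in `C` underlying a homomorphism of monoids in `Mod C`. -/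
@[reducible]
def MonHom.total (F : M ⟶ N) : M.total ⟶ N.total where
  hom := MonHom.hom (M := M.obj) (N := N.obj) (MonHom.hom F)
  cell := BimodHom.cell (MonHom.cell F)
  map_one := congrArg BimodHom.cell (MonHom.map_one F)
  map_mul := congrArg BimodHom.cell (MonHom.map_mul F)

/-- The bimodule in `C` underlying a bimodule in `Mod C`. -/
@[reducible]
def Bimod.total (B : Bimod M N) : Bimod M.total N.total where
  pro := Bimod.pro (M := M.obj) (N := N.obj) B.pro
  left := BimodHom.cell B.left
  right := BimodHom.cell B.right
  one_left := congrArg BimodHom.cell B.one_left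
  mul_left := congrArg BimodHom.cell B.mul_left
  right_one := congrArg BimodHom.cell B.right_one
  right_mul := congrArg BimodHom.cell B.right_mul
  left_right := congrArg BimodHom.cell B.left_right

/-- The unit of a monoid in `Mod C`, as a homomorphism from its base to the underlying monoid in
`C`; it is the identity on objects. -/
noncomputable def Mod.unitHom (M : Mod (Mod C)) : M.obj ⟶ M.total where
  hom := 𝟙 M.obj.obj
  cell := BimodHom.cell (M.obj.unitOf.lift M (𝟙 M.obj)).cell
  map_one := congrArg BimodHom.cell (M.obj.unitOf.lift M (𝟙 M.obj)).map_one
  map_mul := by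
    have h := (M.obj.unitOf.lift M (𝟙 M.obj)).map_mul
    rw [show (M.obj.unitOf.trivialOn).mul = M.obj.unitBimod.leftHom from
      Mod.unitOf_actL M.obj.unitBimod] at h
    exact congrArg BimodHom.cell h

theorem Bimod.two_unitHom_left (B : Bimod M N) :
    comp (P := .cons M.obj.pro (.one (Bimod.pro B.pro)))
      (.two (MonHom.cell M.unitHom) (idc (Bimod.pro B.pro)) rfl) (BimodHom.cell B.left)
      (id_comp _) (id_comp _) = Bimod.left B.pro :=
  congrArg BimodHom.cell ((UnitOf.two_lift_left M.obj.unitOf B).trans (Mod.unitOf_actL B.pro))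

theorem Bimod.two_unitHom_right (B : Bimod M N) :
    comp (P := .cons (Bimod.pro B.pro) (.one N.obj.pro))
      (.two (idc (Bimod.pro B.pro)) (MonHom.cell N.unitHom) rfl) (BimodHom.cell B.right)
      (id_comp _) (id_comp _) = Bimod.right B.pro :=
  congrArg BimodHom.cell ((UnitOf.two_lift_right N.obj.unitOf B).trans (Mod.unitOf_actR B.pro))

/-- A homomorphism of monoids, as a homomorphism of unit bimodules. -/
def MonHom.toBimodHom {M N : Mod C} (F : MonHom M N) :
    BimodHom F F (.one M.unitBimod) N.unitBimod where
  cell := F.cell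
  left := F.map_mul
  right := F.map_mul
  inner := innerCompat_one _

theorem Mod.unitOf_lift_cell {M N : Mod C} (F : M ⟶ N) :
    (UnitOf.lift M.unitOf ⟨N, N.unitOf.trivialOn⟩ F).cell = MonHom.toBimodHom F :=
  M.unitOf.hom_ext ((M.unitOf.unit_extend _).trans (BimodHom.ext
    (MonHom.map_one (M := M) (N := N) F).symm))

theorem Mod.unitHom_comp_total (F : M ⟶ N) :
    M.unitHom ≫ F.total = MonHom.hom F ≫ N.unitHom := by
  have h : M.obj.unitOf.lift M (𝟙 M.obj) ≫ F =
      UnitOf.lift M.obj.unitOf ⟨N.obj, N.obj.unitOf.trivialOn⟩ (MonHom.hom (M := M) (N := N) F) ≫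
        N.obj.unitOf.lift N (𝟙 N.obj) :=
    UnitOf.monHom_ext ((id_comp _).trans (comp_id _).symm)
  have hc := congrArg BimodHom.cell (cell_comp_eq h)
  rw [← MonHom.compOfEq_eq M.unitHom F.total ((id_comp _).trans (comp_id _).symm)]
  refine MonHom.ext_cell (hc.trans ?_)
  exact congrArg (fun t ↦ comp (.one (BimodHom.cell t)) (MonHom.cell N.unitHom) rfl rfl)
    (Mod.unitOf_lift_cell (MonHom.hom F))

theorem MonHom.total_ext {F G : M ⟶ N} (h : MonHom.hom F = MonHom.hom G)
    (ht : F.total = G.total) : F = G := by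
  obtain ⟨f, φ, _, _⟩ := F
  obtain ⟨g, ψ, _, _⟩ := G
  obtain rfl : f = g := h
  exact MonHom.ext_cell (BimodHom.ext (eq_of_heq (MonHom.mk.inj ht).2))

section Extension

variable {M' N' : Mod (Mod C)} {B : Bimod M N} {B' : Bimod M' N'} {F : M.obj ⟶ M'.obj}
  {G : N.obj ⟶ N'.obj} {e : Cell (MonHom.hom F) (MonHom.hom F) (.one M.total.pro) M'.total.pro}
  {e' : Cell (MonHom.hom G) (MonHom.hom G) (.one N.total.pro) N'.total.pro}
  {φ : Cell (MonHom.hom F) (MonHom.hom G) (.one B.total.pro) B'.total.pro}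

theorem Bimod.intertwines_left
    (he : Intertwines (MonHom.cell M.unitHom) (.one (MonHom.cell F)) e (MonHom.cell M'.unitHom))
    (hφ : Intertwines B.total.left (.two e φ rfl) φ B'.total.left) :
    Intertwines (Bimod.left B.pro) (.two (MonHom.cell F) φ rfl) φ (Bimod.left B'.pro) := by
  rw [← B.two_unitHom_left, ← B'.two_unitHom_left]
  exact he.two (.idc φ) hφ (isAppend_two _ _ _)

theorem Bimod.intertwines_right
    (he : Intertwines (MonHom.cell N.unitHom) (.one (MonHom.cell G)) e' (MonHom.cell N'.unitHom))
    (hφ : Intertwines B.total.right (.two φ e' rfl) φ B'.total.right) :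
    Intertwines (Bimod.right B.pro) (.two φ (MonHom.cell G) rfl) φ (Bimod.right B'.pro) := by
  rw [← B.two_unitHom_right, ← B'.two_unitHom_right]
  exact (Intertwines.idc φ).two he hφ (isAppend_two _ _ _)

end Extension

theorem MonHom.exists_total_eq {f : M.obj ⟶ N.obj} {H : M.total ⟶ N.total}
    (h : M.unitHom ≫ H = f ≫ N.unitHom) :
    ∃ F : M ⟶ N, MonHom.hom F = f ∧ F.total = H := by
  obtain ⟨g, e, h_one, h_mul⟩ := H
  obtain rfl : g = MonHom.hom f :=
    ((id_comp g).symm.trans (congrArg MonHom.hom h)).trans (comp_id (MonHom.hom f))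
  have he := MonHom.comp_cell_eq h (id_comp _) (comp_id _)
  let φ : BimodHom f f (.one M.pro) N.pro :=
    ⟨e, Bimod.intertwines_left (B := M.unitBimod) (B' := N.unitBimod) he h_mul,
      Bimod.intertwines_right (B := M.unitBimod) (B' := N.unitBimod) he h_mul, innerCompat_one _⟩
  exact ⟨⟨f, φ, BimodHom.ext h_one, BimodHom.ext h_mul⟩, rfl, rfl⟩

instance UnitOf.isIso_unitHom {X : Mod C} (θ : UnitOf X) :
    IsIso (Mod.unitHom ⟨X, θ.trivialOn⟩) :=
  MonHom.isIso_of_isIsoCell _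
    (IsIsoCell.under (MonHom.isIsoCell_cell (UnitOf.lift X.unitOf ⟨X, θ.trivialOn⟩ (𝟙 X))))

end Total

section Collapse

variable {C : Type u} [Category.{v} C] [VirtualDoubleCategory.{w, z} C] {U : Units (Mod C)}
  {X Y : Mod C} {M : MonoidOn X}

/-- The homomorphism out of the underlying monoid that corresponds to an embedding. -/
noncomputable def embHom (i : Emb U M Y) : Mod.total ⟨X, M⟩ ⟶ Y :=
  (MonHom.total i).compOfEq (inv (U.trivial Y).unitHom)
    ((congrArg (MonHom.hom i.hom ≫ ·) ((comp_id _).symm.trans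
      (hom_comp_eq (IsIso.inv_hom_id (U.trivial Y).unitHom)))).trans (comp_id _))

theorem embHom_comp_unitHom (i : Emb U M Y) :
    embHom i ≫ (U.trivial Y).unitHom = MonHom.total i := by
  rw [embHom, MonHom.compOfEq_eq, Category.assoc, IsIso.inv_hom_id, comp_id]

theorem unitHom_comp_embHom (i : Emb U M Y) : Mod.unitHom ⟨X, M⟩ ≫ embHom i = i.hom := by
  rw [← cancel_mono (U.trivial Y).unitHom, Category.assoc, embHom_comp_unitHom]
  exact Mod.unitHom_comp_total i

theorem embHom_injective : Function.Injective (embHom (U := U) (M := M) (Y := Y)) := by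
  intro i j h
  refine MonHom.total_ext ?_ ?_
  · exact (unitHom_comp_embHom i).symm.trans (h ▸ unitHom_comp_embHom j)
  · rw [← embHom_comp_unitHom, h, embHom_comp_unitHom]

theorem embHom_surjective : Function.Surjective (embHom (U := U) (M := M) (Y := Y)) := by
  intro G
  obtain ⟨i, -, hi⟩ := MonHom.exists_total_eq (M := ⟨X, M⟩) (N := U.trivial Y)
    (f := Mod.unitHom ⟨X, M⟩ ≫ G) (H := G ≫ (U.trivial Y).unitHom) (Category.assoc _ _ _).symm
  refine ⟨i, ?_⟩
  rw [← cancel_mono (U.trivial Y).unitHom, embHom_comp_unitHom, hi]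

theorem embHom_comp {Y' : Mod C} (i : Emb U M Y) (h : Y ⟶ Y') :
    embHom (i.comp (U.trivialHom h)) = embHom i ≫ h := by
  rw [← cancel_mono (U.trivial Y').unitHom, embHom_comp_unitHom, Category.assoc]
  refine Eq.trans ?_ (congrArg (embHom i ≫ ·) (Mod.unitHom_comp_total (U.trivialHom h)))
  rw [← Category.assoc, embHom_comp_unitHom]
  rfl

theorem isCollapse_iff_isIso_embHom {i : Emb U M Y} : IsCollapse i ↔ IsIso (embHom i) := by
  refine ⟨fun hi ↦ ?_, fun _ Z j ↦ ?_⟩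
  · obtain ⟨j, hj⟩ := embHom_surjective (U := U) (M := M) (𝟙 _)
    obtain ⟨k, hk, -⟩ := hi j
    have h : embHom i ≫ k = 𝟙 _ := by rw [← embHom_comp, hk, hj]
    refine ⟨k, h, (hi i).unique (embHom_injective ?_) (embHom_injective ?_)⟩
    · rw [embHom_comp, ← Category.assoc, h, id_comp]
    · rw [embHom_comp, comp_id]
  · refine ⟨inv (embHom i) ≫ embHom j, embHom_injective ?_, ?_⟩
    · rw [embHom_comp, IsIso.hom_inv_id_assoc]
    · rintro k rfl
      rw [embHom_comp, IsIso.inv_hom_id_assoc]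

end Collapse

section BimodCollapse

variable {C : Type u} [Category.{v} C] [VirtualDoubleCategory.{w, z} C] {U : Units (Mod C)}
  {X X' Y Y' : Mod C} {M : MonoidOn X} {N : MonoidOn X'} {i : Emb U M Y} {j : Emb U N Y'}
  {B : Bimod (⟨X, M⟩ : Mod (Mod C)) ⟨X', N⟩} {Q : Bimod Y Y'}

theorem embHom_two_left (φ : Cell i.hom.hom j.hom.hom (.one B.total.pro) Q.pro) :
    comp (.two (MonHom.cell (embHom i)) φ rfl) Q.left (comp_id _) (comp_id _) =
      comp (.two (MonHom.total i).cell φ rfl) (U.trivialBimod Q).total.left (comp_id _)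
        (comp_id _) :=
  (congrArg (comp (.two (MonHom.cell (embHom i)) φ rfl) · (comp_id _) (comp_id _))
    (Bimod.two_unitHom_left (U.trivialBimod Q)).symm).trans
    (comp_comp_two (isAppend_two _ _ _) (cell_comp_eq (embHom_comp_unitHom i)) (comp_idc φ))

theorem embHom_two_right (φ : Cell i.hom.hom j.hom.hom (.one B.total.pro) Q.pro) :
    comp (.two φ (MonHom.cell (embHom j)) rfl) Q.right (comp_id _) (comp_id _) =
      comp (.two φ (MonHom.total j).cell rfl) (U.trivialBimod Q).total.right (comp_id _)
        (comp_id _) :=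
  (congrArg (comp (.two φ (MonHom.cell (embHom j)) rfl) · (comp_id _) (comp_id _))
    (Bimod.two_unitHom_right (U.trivialBimod Q)).symm).trans
    (comp_comp_two (isAppend_two _ _ _) (comp_idc φ) (cell_comp_eq (embHom_comp_unitHom j)))

/-- The bimodule homomorphism in `C` that is the cell of a bimodule embedding in `Mod C`. -/
abbrev embCell (φ : BimodEmb U i j B Q) : BimodHom i.hom j.hom (.one B.pro) Q :=
  φ.cell

/-- The homomorphism out of the underlying bimodule that corresponds to a bimodule embedding. -/
noncomputable def bimodEmbHom (φ : BimodEmb U i j B Q) :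
    BimodHom (embHom i) (embHom j) (.one B.total) Q where
  cell := (embCell φ).cell
  left := (congrArg BimodHom.cell φ.left).trans (embHom_two_left _).symm
  right := (congrArg BimodHom.cell φ.right).trans (embHom_two_right _).symm
  inner := innerCompat_one _

theorem exists_bimodEmb (ψ : BimodHom (embHom i) (embHom j) (.one B.total) Q) :
    ∃ φ : BimodEmb U i j B Q, (embCell φ).cell = ψ.cell := by
  have hi := MonHom.comp_cell_eq (Mod.unitHom_comp_total i) (id_comp _) (comp_id _)
  have hj := MonHom.comp_cell_eq (Mod.unitHom_comp_total j) (id_comp _) (comp_id _)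
  have h_left := ψ.left.trans (embHom_two_left _)
  have h_right := ψ.right.trans (embHom_two_right _)
  let φ : BimodHom i.hom j.hom (.one B.pro) Q :=
    ⟨ψ.cell, Bimod.intertwines_left (B := B) (B' := U.trivialBimod Q) hi h_left,
      Bimod.intertwines_right (B := B) (B' := U.trivialBimod Q) hj h_right, innerCompat_one _⟩
  exact ⟨⟨φ, BimodHom.ext h_left, BimodHom.ext h_right, innerCompat_one _⟩, rfl⟩

theorem isBimodCollapse_of_isIsoCell [IsIso (embHom i)] [IsIso (embHom j)]
    {φ : BimodEmb U i j B Q} (hφ : IsIsoCell (P := B.total.pro) (embCell φ).cell) :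
    IsBimodCollapse φ := by
  refine ⟨isCollapse_iff_isIso_embHom.2 inferInstance, isCollapse_iff_isIso_embHom.2 inferInstance,
    fun Z Z' h k R ψ ↦ ?_⟩
  have hΦ : IsIsoCell (C := Mod C) (bimodEmbHom φ) :=
    (BimodHom.isCartesian_of_cell (φ := bimodEmbHom φ) hφ.isCartesian).isIsoCell
  obtain ⟨χ, hχ, h_unique⟩ := hΦ.existsUnique_precomp (embHom_comp i h).symm
    (embHom_comp j k).symm (bimodEmbHom ψ)
  have h := congrArg BimodHom.cell hχ
  refine ⟨χ, BimodHom.ext h, fun χ' hχ' ↦ h_unique χ' (BimodHom.ext ?_)⟩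
  have h' := congrArg BimodHom.cell hχ'
  exact h'

theorem IsBimodCollapse.isIsoCell {φ : BimodEmb U i j B Q} (hφ : IsBimodCollapse φ) :
    IsIsoCell (P := B.total.pro) (embCell φ).cell := by
  obtain ⟨hi, hj, h_univ⟩ := hφ
  have := isCollapse_iff_isIso_embHom.1 hi
  have := isCollapse_iff_isIso_embHom.1 hj
  suffices IsIsoCell (C := Mod C) (bimodEmbHom φ) from this.under
  refine isIsoCell_of_existsUnique_precomp fun Z Z' h k u v hu hv R ψ ↦ ?_
  rw [← embHom_comp] at hu hv
  subst hu hv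
  obtain ⟨ψ', hψ'⟩ := exists_bimodEmb ψ
  obtain ⟨χ, hχ, h_unique⟩ := h_univ h k R ψ'
  refine ⟨χ, BimodHom.ext ((congrArg BimodHom.cell hχ).trans hψ'), fun χ' hχ' ↦
    h_unique χ' (BimodHom.ext ((congrArg BimodHom.cell hχ').trans hψ'.symm))⟩

end BimodCollapse

section Regular

variable {C : Type u} [Category.{v} C] [VirtualDoubleCategory.{w, z} C] {U : Units (Mod C)}
  {X X' Y Y' : Mod C} {M : MonoidOn X} {N : MonoidOn X'} {i : Emb U M Y} {j : Emb U N Y'}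

theorem isIsoCell_embHom_iff : IsIsoCell (MonHom.cell (embHom i)) ↔
    IsIsoCell (P := (Mod.total ⟨X, M⟩).pro) (BimodHom.cell i.cell) := by
  have h_unit := MonHom.isIsoCell_cell (U.trivial Y).unitHom
  have h_inv := MonHom.isIsoCell_cell (inv (U.trivial Y).unitHom)
  refine ⟨fun h ↦ ?_, fun h ↦ h.comp h_inv⟩
  have h_comp : comp (.one (MonHom.cell (embHom i))) (MonHom.cell (U.trivial Y).unitHom)
      (comp_id _) (comp_id _) = BimodHom.cell i.cell := cell_comp_eq (embHom_comp_unitHom i)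
  exact h_comp ▸ h.comp h_unit

theorem isNormalCollapse_of_isIso [IsIso (embHom i)] : IsNormalCollapse i :=
  ⟨isCollapse_iff_isIso_embHom.2 inferInstance, isBimodCollapse_of_isIsoCell
    (isIsoCell_embHom_iff.1 (MonHom.isIsoCell_cell (embHom i)))⟩

variable (U M) in
theorem hasNormalCollapse_mod : HasNormalCollapse U M := by
  obtain ⟨i, hi⟩ := embHom_surjective (U := U) (M := M) (𝟙 _)
  have : IsIso (embHom i) := hi ▸ inferInstance
  exact ⟨_, i, isNormalCollapse_of_isIso⟩

theorem IsKernel.isIso_embHom (hC : HasRestrictions C) {F : X ⟶ Y} [IsIso (MonHom.hom F)]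
    (hi : IsKernel F i) : IsIso (embHom i) := by
  obtain ⟨rfl, hi⟩ := hi
  exact MonHom.isIso_of_isIsoCell _
    (isIsoCell_embHom_iff.2 ((BimodHom.isCartesian_iff_isIsoCell hC).1 hi))

theorem isRegularCover_iff_isIso_hom (hC : HasRestrictions C) {F : X ⟶ Y} :
    IsRegularCover U F ↔ IsIso (MonHom.hom F) := by
  refine ⟨?_, fun hF ↦ ?_⟩
  · rintro ⟨M, i, ⟨rfl, -⟩, hi, -⟩
    have := isCollapse_iff_isIso_embHom.1 hi
    exact MonHom.isIso_hom (embHom i)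
  · obtain ⟨P, κ, hκ⟩ := (isVirtualEquipment_mod hC).has_restrictions F F (U.unit Y).pro
    obtain ⟨M, i, hi⟩ := MonoidOn.exists_restrict (U.unit Y).trivialOn hκ
    have : IsKernel F i := hi
    have := this.isIso_embHom hC
    exact ⟨M, i, hi, isNormalCollapse_of_isIso⟩

theorem IsRegularCover.isCartesian_iff_isIsoCell (hC : HasRestrictions C) {F : X ⟶ Y}
    {G : X' ⟶ Y'} (hF : IsRegularCover U F) (hG : IsRegularCover U G) {A : Bimod X X'}
    {B : Bimod Y Y'} {φ : BimodHom F G (.one A) B} :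
    IsCartesian (C := Mod C) φ ↔ IsIsoCell (P := A.pro) φ.cell := by
  have := (isRegularCover_iff_isIso_hom hC).1 hF
  have := (isRegularCover_iff_isIso_hom hC).1 hG
  exact BimodHom.isCartesian_iff_isIsoCell hC

theorem IsRegularCover.isBimodCollapse_iff_isCartesian (hC : HasRestrictions C) {F : X ⟶ Y}
    {G : X' ⟶ Y'} (hF : IsRegularCover U F) (hG : IsRegularCover U G) (hi : IsKernel F i)
    (hj : IsKernel G j) {A : Bimod (⟨X, M⟩ : Mod (Mod C)) ⟨X', N⟩} {B : Bimod Y Y'}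
    {φ : BimodEmb U i j A B} : IsBimodCollapse φ ↔ IsCartesian φ.cell := by
  have := (isRegularCover_iff_isIso_hom hC).1 hF
  have := (isRegularCover_iff_isIso_hom hC).1 hG
  have := hi.isIso_embHom hC
  have := hj.isIso_embHom hC
  obtain ⟨rfl, -⟩ := hi
  obtain ⟨rfl, -⟩ := hj
  exact Iff.trans ⟨IsBimodCollapse.isIsoCell, isBimodCollapse_of_isIsoCell⟩
    (hF.isCartesian_iff_isIsoCell hC hG (φ := embCell φ)).symm

end Regular

end VDC

theorem mainTheorem4_general {C : Type u} [Category.{v} C] [VDC.VirtualDoubleCategory.{w, z} C]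
    (hC : VDC.HasRestrictions C) :
    VDC.IsRegularVirtualEquipment (VDC.Mod C) ∧
    ∀ U : VDC.Units (VDC.Mod C),
      (∀ (X : VDC.Mod C) (M : VDC.MonoidOn X), VDC.HasNormalCollapse U M) ∧
      (∀ (X Y : VDC.Mod C) (F : X ⟶ Y),
        VDC.IsRegularCover U F ↔ IsIso (VDC.MonHom.hom F)) ∧
      (∀ (X X' Y Y' : VDC.Mod C) (F : X ⟶ Y) (G : X' ⟶ Y'),
        VDC.IsRegularCover U F → VDC.IsRegularCover U G →
        (∀ (A : VDC.Bimod X X') (B : VDC.Bimod Y Y') (φ : VDC.BimodHom F G (.one A) B),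
          VDC.IsCartesian (C := VDC.Mod C) φ ↔ VDC.IsIsoCell φ.cell) ∧
        (∀ (M : VDC.MonoidOn X) (N : VDC.MonoidOn X') (i : VDC.Emb U M Y) (j : VDC.Emb U N Y'),
          VDC.IsKernel F i → VDC.IsKernel G j →
          ∀ (A : VDC.Bimod (⟨X, M⟩ : VDC.Mod (VDC.Mod C)) ⟨X', N⟩) (B : VDC.Bimod Y Y')
            (φ : VDC.BimodEmb U i j A B),
            VDC.IsBimodCollapse φ ↔ VDC.IsCartesian φ.cell)) :=
  ⟨⟨VDC.isVirtualEquipment_mod hC,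
      fun U _ M _ ↦ VDC.hasNormalCollapse_mod U M,
      fun _ _ _ _ _ _ _ hF hG _ _ _ _ hi hj _ _ _ ↦
        (hF.isBimodCollapse_iff_isCartesian hC hG hi hj).2⟩,
    fun U ↦ ⟨fun _ M ↦ VDC.hasNormalCollapse_mod U M,
      fun _ _ _ ↦ VDC.isRegularCover_iff_isIso_hom hC,
      fun _ _ _ _ _ _ hF hG ↦ ⟨fun _ _ _ ↦ hF.isCartesian_iff_isIsoCell hC hG,
        fun _ _ _ _ hi hj _ _ _ ↦ hF.isBimodCollapse_iff_isCartesian hC hG hi hj⟩⟩⟩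

theorem mainTheorem4 {C : Type u} [Category.{v} C] [VDC.VirtualDoubleCategory.{w, z} C]
    (hC : VDC.IsVirtualEquipment C) :
    VDC.IsRegularVirtualEquipment (VDC.Mod C) ∧
    ∀ U : VDC.Units (VDC.Mod C),
      (∀ (X : VDC.Mod C) (M : VDC.MonoidOn X), VDC.HasNormalCollapse U M) ∧
      (∀ (X Y : VDC.Mod C) (F : X ⟶ Y),
        VDC.IsRegularCover U F ↔ IsIso (VDC.MonHom.hom F)) ∧
      (∀ (X X' Y Y' : VDC.Mod C) (F : X ⟶ Y) (G : X' ⟶ Y'),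
        VDC.IsRegularCover U F → VDC.IsRegularCover U G →
        (∀ (A : VDC.Bimod X X') (B : VDC.Bimod Y Y') (φ : VDC.BimodHom F G (.one A) B),
          VDC.IsCartesian (C := VDC.Mod C) φ ↔ VDC.IsIsoCell φ.cell) ∧
        (∀ (M : VDC.MonoidOn X) (N : VDC.MonoidOn X') (i : VDC.Emb U M Y) (j : VDC.Emb U N Y'),
          VDC.IsKernel F i → VDC.IsKernel G j →
          ∀ (A : VDC.Bimod (⟨X, M⟩ : VDC.Mod (VDC.Mod C)) ⟨X', N⟩) (B : VDC.Bimod Y Y')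
            (φ : VDC.BimodEmb U i j A B),
            VDC.IsBimodCollapse φ ↔ VDC.IsCartesian φ.cell)) :=
  mainTheorem4_general hC.has_restrictions
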